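/- A tree is a nonempty partially ordered set in which the set of predecessors of every element is well-ordered; a branch is a maximal chain, and its length is its order type. A $(\lambda,\kappa)$-tree is a tree in which every branch has length less than $\kappa$ and every element has fewer than $\lambda$ immediate successors. A $(\lambda,\kappa)$-tree $T$ is called semi-proper if forcing with $T$ (ordered upside down, so that larger elements of $T$ are stronger conditions) adds a $\kappa$-branch to $T$ (a branch of length $\kappa$), preserves stationary subsets of $\kappa$ (every stationary subset of $\kappa$ in the ground model $V$ remains stationary in the generic extension), and adds no new sets of cardinality less than $\kappa$ (every set $x\subseteq V$ in the generic extension that has cardinality less than $\kappa$ there belongs to $V$). Theorem (ZFC). For every regular cardinal $\kappa>\aleph_1$ there exists a semi-proper $((2^{\kappa})^{+},\kappa)$-tree. -/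

import Mathlib

universe u

open Cardinal Order

namespace SetForcing

/-! ## Names and the forcing relation

A forcing notion is a nonempty preordered set `P`; `p ≤ q` means that `p` is stronger than `q`. -/

/-- `P`-names: a name is a set of pairs `(σ, c)` with `σ` a `P`-name and `c ∈ P`.  The constructor
presents the set `{(name i, cond i) : i ∈ ι}`. -/
inductive PName (P : Type u) : Type (u + 1)
  | mk (ι : Type u) (name : ι → PName P) (cond : ι → P) : PName P

/-- A statement of the forcing language, given by the conditions that force it. -/
abbrev Stmt (P : Type u) : Type u := P → Prop

namespace PName

variable {P : Type u}

/-- The canonical name `x̌ = {(y̌, p) : y ∈ x, p ∈ P}` of the ground model set `x`. -/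
def check : PSet.{u} → PName P
  | ⟨ι, A⟩ => mk (ι × P) (fun i => check (A i.1)) (fun i => i.2)

/-- A name for the unordered pair `{σ, τ}`. -/
def upair (σ τ : PName P) : PName P :=
  mk (ULift.{u} Bool × P) (fun i => cond i.1.down σ τ) (fun i => i.2)

/-- A name for the ordered pair `⟨σ, τ⟩ = {{σ}, {σ, τ}}`. -/
def opair (σ τ : PName P) : PName P := upair (upair σ σ) (upair σ τ)

end PName

section Relation

variable {P : Type u} [Preorder P]

/-- `p ⊩ σ = τ`: whenever `(σ', c) ∈ σ` and `q ≤ p, c`, then densely below `q` there are `r` and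
`(τ', d) ∈ τ` with `r ≤ d` and `r ⊩ σ' = τ'`; and the same with `σ` and `τ` exchanged. -/
def feq : PName P → PName P → Stmt P
  | ⟨ι, a, c⟩, ⟨κ, b, d⟩ => fun p =>
    (∀ i : ι, ∀ q ≤ p, q ≤ c i → ∃ r ≤ q, ∃ j : κ, r ≤ d j ∧ feq (a i) (b j) r) ∧
    (∀ j : κ, ∀ q ≤ p, q ≤ d j → ∃ r ≤ q, ∃ i : ι, r ≤ c i ∧ feq (a i) (b j) r)

/-- `p ⊩ σ ∈ τ`: densely below `p` there are `r` and `(τ', d) ∈ τ` with `r ≤ d`, `r ⊩ σ = τ'`. -/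
def fmem (σ : PName P) : PName P → Stmt P
  | ⟨κ, b, d⟩ => fun p => ∀ q ≤ p, ∃ r ≤ q, ∃ j : κ, r ≤ d j ∧ feq σ (b j) r

/-- `p ⊩ φ ∧ ψ`. -/
def fand (φ ψ : Stmt P) : Stmt P := fun p => φ p ∧ ψ p

/-- `p ⊩ φ ∨ ψ`: densely below `p` one of the two is forced. -/
def for_ (φ ψ : Stmt P) : Stmt P := fun p => ∀ q ≤ p, ∃ r ≤ q, φ r ∨ ψ r

/-- `p ⊩ φ → ψ`: no `q ≤ p` forces both `φ` and `¬ψ`. -/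
def fimp (φ ψ : Stmt P) : Stmt P := fun p => ∀ q ≤ p, φ q → ∃ r ≤ q, ψ r

/-- `p ⊩ ∀ x, φ x`; the variable may range over all names or over ground model objects. -/
def fall {ι : Type*} (φ : ι → Stmt P) : Stmt P := fun p => ∀ x, φ x p

/-- `p ⊩ ∃ x, φ x`: densely below `p` there is a witness. -/
def fex {ι : Type*} (φ : ι → Stmt P) : Stmt P := fun p => ∀ q ≤ p, ∃ r ≤ q, ∃ x, φ x r

/-- Bounded quantifier `∀ x ∈ σ, φ x`. -/
def fallIn (σ : PName P) (φ : PName P → Stmt P) : Stmt P := fall fun x => fimp (fmem x σ) (φ x)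

/-- Bounded quantifier `∃ x ∈ σ, φ x`. -/
def fexIn (σ : PName P) (φ : PName P → Stmt P) : Stmt P := fex fun x => fand (fmem x σ) (φ x)

/-- `⊩ φ`: every condition forces `φ`. -/
def Forced (φ : Stmt P) : Prop := ∀ p : P, φ p

/-! ## Statements about the generic extension -/

/-- `x ∈ V`: `x` is a set of the ground model. -/
def fground (x : PName P) : Stmt P := fex fun z : PSet.{u} => feq x (PName.check z)

/-- `f` is a bijective function from `X` onto `Y`, as a set of ordered pairs. -/
def fbij (f X Y : PName P) : Stmt P :=
  fand (fallIn f fun z => fexIn X fun a => fexIn Y fun b => feq z (PName.opair a b)) <|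
  fand (fallIn X fun a => fexIn Y fun b => fand (fmem (PName.opair a b) f)
    (fallIn Y fun b' => fimp (fmem (PName.opair a b') f) (feq b' b))) <|
  fallIn Y fun b => fexIn X fun a => fand (fmem (PName.opair a b) f)
    (fallIn X fun a' => fimp (fmem (PName.opair a' b) f) (feq a' a))

/-- `C` is a closed unbounded subset of the limit ordinal `k`. -/
def fclub (C k : PName P) : Stmt P :=
  fand (fallIn C fun a => fmem a k) <|
  fand (fallIn k fun a => fexIn C fun b => fmem a b) <|
  fallIn k fun d => fimp
    (fand (fex fun a => fmem a d)
      (fallIn d fun a => fexIn C fun b => fand (fmem a b) (fmem b d)))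
    (fmem d C)

/-- `S` is stationary in `k`: it meets every closed unbounded subset of `k`. -/
def fstationary (S k : PName P) : Stmt P :=
  fall fun C => fimp (fclub C k) (fexIn C fun a => fmem a S)

end Relation

/-! ## Preservation properties of a forcing notion -/

/-- A set of ordinals below `κ`, as a set of von Neumann ordinals. -/
noncomputable def ordinalSet {κ : Cardinal.{u}} (S : Set κ.ord.ToType) : PSet.{u} :=
  ⟨S, fun a => (Ordinal.ToType.toOrd a.1 : Ordinal.{u}).toPSet⟩

/-- Every stationary `S ⊆ κ` of the ground model stays stationary in the extension. -/
def PreservesStationary (P : Type u) [Preorder P] (κ : Cardinal.{u}) : Prop :=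
  ∀ S : Set κ.ord.ToType, IsStationary S →
    Forced (P := P) (fstationary (PName.check (ordinalSet S)) (PName.check κ.ord.toPSet))

/-- No new sets of cardinality less than `κ`: in the extension, each set of ground model elements
that is equinumerous with an ordinal below `κ` belongs to the ground model. -/
def AddsNoSmallSets (P : Type u) [Preorder P] (κ : Cardinal.{u}) : Prop :=
  Forced (P := P) <| fall fun x => fimp
    (fand (fallIn x fground)
      (fexIn (PName.check κ.ord.toPSet) fun a => fex fun f => fbij f a x))
    (fground x)

/-! ## Trees -/

/-- A tree: a nonempty partial order in which the predecessors of each element are well-ordered. -/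
structure IsTree (T : Type u) [PartialOrder T] : Prop where
  nonempty : Nonempty T
  wellOrdered : ∀ x : T, IsWellOrder (Set.Iio x) (· < ·)

/-- A `(lam, κ)`-tree: every branch (maximal chain) is well-ordered in type less than `κ`, and
every element has less than `lam` immediate successors. -/
structure IsCardTree (lam κ : Cardinal.{u}) (T : Type u) [PartialOrder T] : Prop
    extends IsTree T where
  branch_lt : ∀ B : Set T, IsMaxChain (· ≤ ·) B →
    ∃ _ : IsWellOrder B (· < ·), Ordinal.type (fun x y : B => x < y) < κ.ord
  succ_lt : ∀ x : T, #{y : T // x ⋖ y} < lam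

/-- A fixed injection of a ground model type into the sets, which makes `T` a ground model set. -/
noncomputable def code {T : Type u} (t : T) : PSet.{u} :=
  (Ordinal.typein (WellOrderingRel (α := T)) t).toPSet

/-- `T` as a ground model set. -/
noncomputable def codeSet (T : Type u) : PSet.{u} := ⟨T, code⟩

section Branch

variable {P : Type u} [Preorder P] (T : Type u) [PartialOrder T]

/-- `x <_T y` in the extension. -/
noncomputable def ftreeLT (x y : PName P) : Stmt P :=
  fex fun st : {st : T × T // st.1 < st.2} =>
    fand (feq x (PName.check (code st.1.1))) (feq y (PName.check (code st.1.2)))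

/-- `x` and `y` are comparable in `T`. -/
noncomputable def fcomparable (x y : PName P) : Stmt P :=
  for_ (feq x y) (for_ (ftreeLT T x y) (ftreeLT T y x))

/-- `B` is a branch of `T`: a maximal chain. -/
noncomputable def fbranch (B : PName P) : Stmt P :=
  fand (fallIn B fun x => fmem x (PName.check (codeSet T))) <|
  fand (fallIn B fun x => fallIn B fun y => fcomparable T x y) <|
  fallIn (PName.check (codeSet T)) fun x =>
    fimp (fallIn B fun y => fcomparable T x y) (fmem x B)

/-- `T` has a `k`-branch: a branch `B` with an order isomorphism `f` from `(k, ∈)` to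
`(B, <_T)`. -/
noncomputable def fhasBranch (k : PName P) : Stmt P :=
  fex fun B => fand (fbranch T B) <| fex fun f => fand (fbij f k B) <|
    fallIn k fun a => fallIn k fun b => fimp (fmem a b) <|
      fallIn B fun x => fallIn B fun y =>
        fimp (fmem (PName.opair a x) f) (fimp (fmem (PName.opair b y) f) (ftreeLT T x y))

end Branch

/-- Forcing with `P` adds a `κ`-branch to `T`. -/
def AddsBranch (P : Type u) [Preorder P] (T : Type u) [PartialOrder T] (κ : Cardinal.{u}) : Prop :=
  Forced (P := P) (fhasBranch T (PName.check κ.ord.toPSet))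

/-- `T` is a semi-proper `(lam, κ)`-tree: the forcing notion `T`, with the order inverted, adds a
`κ`-branch to `T`, preserves stationary subsets of `κ`, and adds no sets of cardinality less
than `κ`. -/
structure IsSemiProperTree (lam κ : Cardinal.{u}) (T : Type u) [PartialOrder T] : Prop
    extends IsCardTree lam κ T where
  addsBranch : AddsBranch Tᵒᵈ T κ
  preservesStationary : PreservesStationary Tᵒᵈ κ
  addsNoSmallSets : AddsNoSmallSets Tᵒᵈ κ

end SetForcing

-- A tree forcing is controlled here by one combinatorial property, `Hits`: for every strategy of
-- extending conditions and every stationary `S`, some `i ∈ S` and some condition `q` are such that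
-- `q` is stronger than moves of the strategy made at heights cofinal in `i`. Applied to a strategy
-- that forces elements into a named club, this preserves stationary sets; applied to a strategy
-- that meets given dense sets one after another, it gives distributivity below `κ`, hence no new
-- small sets, and conditions of every level below `κ` are dense, hence a `κ`-branch. By
-- `isSemiProperTree_of_hits` it remains to find a tree of size at most `2 ^ κ` that hits, has
-- arbitrarily high extensions, and has no chain of unbounded height. Two trees are considered.
--
-- The first, `LadderTree`, consists of initial segments of coherent systems of clubs labelled by
-- stationary sets. It always hits: play the strategy, taking at limit stages the set of earlier
-- heights as club and `S` as label. Only a limit stage whose height lies in `S` can block the play,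
-- and such a stage is the desired hit; if none occurred, the heights would form a continuous
-- increasing sequence of length `κ`, with a fixed point in `S`. If all chains of this tree are
-- bounded, it proves the theorem.
--
-- Otherwise an unbounded chain yields a coherent system `C`, and the labels exclude a thread. A
-- club-guessing argument (`exists_gapEnds`, using `κ > ℵ₁`) gives a club `E₀` such that every club
-- `E` has a limit point `δ` at which `E` contains cofinally many last points of `E₀` in gaps of `C
-- δ`. The second tree, `GapTree`, consists of closed bounded sets containing only boundedly many
-- such points at each of their limits. An unbounded chain would have a club as union, against
-- guessing. The tree hits because the strategy can be played inside the gaps of `C i`, leaving a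
-- point of `E₀` before the end of each gap used; coherence makes the limits of such a play legal.
-- If these plays stopped early for stationarily many `i`, Fodor's lemma would put a tail of one
-- club into `C i` for stationarily many `i`, which produces a thread.

universe v

set_option linter.unusedSectionVars false

/-- A well-order of regular type greater than `ω₁`. -/
class LargeRegular (K : Type u) [LinearOrder K] [WellFoundedLT K] : Prop where
  bounded : ∀ {ι : Type u} (f : ι → K), #ι < #K → ∃ b, ∀ i, f i < b
  mk_Iio_lt : ∀ a : K, #(Set.Iio a) < #K
  aleph_one_lt : ℵ₁ < #K

theorem largeRegular_ord_toType {κ : Cardinal.{u}} (hreg : κ.IsRegular) (hκ : ℵ₁ < κ) :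
    LargeRegular κ.ord.ToType where
  bounded := by
    intro ι f hι
    rw [mk_ord_toType] at hι
    have h : ¬ IsCofinal (Set.range f) := by
      intro h
      have := Order.cof_le h
      rw [Ordinal.cof_toType, hreg.cof_ord] at this
      exact absurd (this.trans mk_range_le) (not_le.2 hι)
    obtain ⟨b, hb⟩ := not_isCofinal_iff.1 h
    exact ⟨b, fun i => hb _ ⟨i, rfl⟩⟩
  mk_Iio_lt a := by
    simpa using mk_Iio_lt a (by simp)
  aleph_one_lt := by rwa [mk_ord_toType]


/-! ### Clubs, stationary sets and Fodor's lemma in a regular well-order -/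

namespace LargeRegular

section Clubs

variable {K : Type u} [LinearOrder K] [WellFoundedLT K]

/-- `δ` is a limit point of `X`. -/
def Acc (X : Set K) (δ : K) : Prop := (∃ η, η < δ) ∧ ∀ η < δ, ∃ x ∈ X, η < x ∧ x < δ

theorem Acc.mono {X Y : Set K} {δ : K} (h : Acc X δ) (hXY : X ⊆ Y) : Acc Y δ :=
  ⟨h.1, fun η hη => by obtain ⟨x, hx, h⟩ := h.2 η hη; exact ⟨x, hXY hx, h⟩⟩

theorem Acc.of_tail {X Y : Set K} {δ γ : K} (h : Acc X δ) (hγ : γ < δ)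
    (hXY : ∀ x ∈ X, γ < x → x < δ → x ∈ Y) : Acc Y δ := by
  refine ⟨h.1, fun η hη => ?_⟩
  obtain ⟨x, hx, h1, h2⟩ := h.2 (max η γ) (max_lt hη hγ)
  exact ⟨x, hXY x hx ((le_max_right _ _).trans_lt h1) h2, (le_max_left _ _).trans_lt h1, h2⟩

variable [hK : LargeRegular K]

theorem aleph0_lt_mk : ℵ₀ < #K := aleph0_lt_aleph_one.trans hK.aleph_one_lt

instance : Infinite K := infinite_iff.2 (aleph0_lt_mk (K := K)).le

instance : NoMaxOrder K where
  exists_gt a := by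
    obtain ⟨b, hb⟩ := hK.bounded (fun _ : PUnit.{u+1} => a)
      (by simpa using one_lt_aleph0.trans aleph0_lt_mk)
    exact ⟨b, hb ⟨⟩⟩

theorem isClub_iff_acc {E : Set K} :
    IsClub E ↔ (∀ δ, Acc E δ → δ ∈ E) ∧ ∀ η, ∃ x ∈ E, η < x := by
  constructor
  · intro h
    refine ⟨fun δ hδ => ?_, fun η => ?_⟩
    · have hne : (E ∩ Set.Iio δ).Nonempty := by
        obtain ⟨η, hη⟩ := hδ.1
        obtain ⟨x, hx, -, h2⟩ := hδ.2 η hη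
        exact ⟨x, hx, h2⟩
      refine h.isLUB_mem (t := E ∩ Set.Iio δ) Set.inter_subset_left hne ⟨fun x hx => hx.2.le, ?_⟩
      intro b hb
      by_contra hlt
      obtain ⟨x, hx, h1, h2⟩ := hδ.2 b (not_le.1 hlt)
      exact absurd (hb ⟨hx, h2⟩) (not_le.2 h1)
    · obtain ⟨b, hb⟩ := exists_gt η
      obtain ⟨x, hx, hbx⟩ := h.isCofinal b
      exact ⟨x, hx, hb.trans_le hbx⟩
  · rintro ⟨h1, h2⟩
    refine ⟨?_, fun η => ?_⟩
    · intro d hd hne _ a ha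
      by_cases had : a ∈ d
      · exact hd had
      · apply h1
        obtain ⟨y, hy⟩ := hne
        have hlt : ∀ x ∈ d, x < a := fun x hx =>
          lt_of_le_of_ne (ha.1 hx) (fun h => had (h ▸ hx))
        refine ⟨⟨y, hlt y hy⟩, fun η hη => ?_⟩
        by_contra hcon
        push Not at hcon
        refine absurd (ha.2 (fun x hx => ?_)) (not_le.2 hη)
        by_contra hx'
        exact absurd (hcon x (hd hx) (not_le.1 hx')) (not_le.2 (hlt x hx))
    · obtain ⟨x, hx, hlt⟩ := h2 η
      exact ⟨x, hx, hlt.le⟩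

theorem cof_eq_mk : Order.cof K = #K := by
  refine le_antisymm (Order.cof_le_cardinalMk K) (Order.le_cof_iff.2 fun s hs => ?_)
  by_contra h
  obtain ⟨b, hb⟩ := hK.bounded (fun x : s => (x : K)) (not_le.1 h)
  obtain ⟨x, hx, hbx⟩ := hs b
  exact absurd (hb ⟨x, hx⟩) (not_lt.2 hbx)

theorem cof_ne_aleph0 : Order.cof K ≠ ℵ₀ := by
  rw [cof_eq_mk]; exact (aleph0_lt_mk (K := K)).ne'

theorem isClub_iInter {ι : Type u} (hι : #ι < #K) {E : ι → Set K} (hE : ∀ i, IsClub (E i)) :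
    IsClub (⋂ i, E i) :=
  IsClub.iInter cof_ne_aleph0 (by simpa [cof_eq_mk] using hι) hE

theorem isClub_inter {E F : Set K} (hE : IsClub E) (hF : IsClub F) : IsClub (E ∩ F) :=
  hE.inter cof_ne_aleph0 hF

theorem isClub_Ioi (a : K) : IsClub (Set.Ioi a) := by
  rw [isClub_iff_acc]
  refine ⟨fun δ hδ => ?_, fun η => ?_⟩
  · obtain ⟨η, hη⟩ := hδ.1
    obtain ⟨x, hx, -, h2⟩ := hδ.2 η hη
    exact lt_trans hx h2
  · obtain ⟨b, hb⟩ := exists_gt (max a η)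
    exact ⟨b, (le_max_left _ _).trans_lt hb, (le_max_right _ _).trans_lt hb⟩

theorem bounded_lift {ι : Type v} (f : ι → K)
    (hι : Cardinal.lift.{u} #ι < Cardinal.lift.{v} #K) : ∃ b, ∀ i, f i < b := by
  obtain ⟨b, hb⟩ := hK.bounded (fun x : Set.range f => (x : K)) (by
    rw [← Cardinal.lift_lt.{u, v}]
    exact mk_range_le_lift.trans_lt hι)
  exact ⟨b, fun i => hb ⟨_, i, rfl⟩⟩

/-- The least strict upper bound of a strictly increasing family without maximum. -/
theorem exists_isLUB_of_strictMono {ι : Type v} [LinearOrder ι] [NoMaxOrder ι] [Nonempty ι]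
    (hι : Cardinal.lift.{u} #ι < Cardinal.lift.{v} #K) {s : ι → K} (hs : StrictMono s) :
    ∃ δ, (∀ i, s i < δ) ∧ ∀ η < δ, ∃ i, η < s i := by
  have hne : {b | ∀ i, s i < b}.Nonempty := bounded_lift s hι
  refine ⟨wellFounded_lt.min _ hne, wellFounded_lt.min_mem _ hne, fun η hη => ?_⟩
  by_contra hcon
  push Not at hcon
  refine wellFounded_lt.not_lt_min _ (x := η) (fun i => ?_) hη
  obtain ⟨j, hj⟩ := exists_gt i
  exact (hs hj).trans_le (hcon j)

theorem acc_of_isLUB {ι : Type v} [LinearOrder ι] [Nonempty ι] {s : ι → K} {E : Set K} {δ : K}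
    (hsE : ∀ i, s i ∈ E) (h1 : ∀ i, s i < δ) (h2 : ∀ η < δ, ∃ i, η < s i) : Acc E δ := by
  refine ⟨⟨_, h1 (Classical.arbitrary ι)⟩, fun η hη => ?_⟩
  obtain ⟨i, hi⟩ := h2 η hη
  exact ⟨s i, hsE i, hi, h1 i⟩

/-- For unboundedness, iterate a function `g` with `g x` in every `E γ`, `γ ≤ x`. The supremum of
`ω` iterates is a limit point of each `E γ` with `γ` below it. -/
theorem isClub_diag {E : K → Set K} (hE : ∀ γ, IsClub (E γ)) :
    IsClub {δ | ∀ γ < δ, δ ∈ E γ} := by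
  rw [isClub_iff_acc]
  constructor
  · intro δ hδ γ hγ
    exact (isClub_iff_acc.1 (hE γ)).1 δ (hδ.of_tail hγ fun x hx hγx _ => hx γ hγx)
  · intro η
    have hex : ∀ x : K, ∃ y, x < y ∧ ∀ γ, γ ≤ x → y ∈ E γ := by
      intro x
      have hc : IsClub (⋂ γ : Set.Iic x, E γ) := by
        refine isClub_iInter (ι := Set.Iic x) ?_ fun γ => hE γ
        obtain ⟨b, hb⟩ := exists_gt x
        exact (mk_le_mk_of_subset fun z (hz : z ≤ x) => hz.trans_lt hb).trans_lt (hK.mk_Iio_lt b)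
      obtain ⟨y, hy, hxy⟩ := (isClub_iff_acc.1 hc).2 x
      exact ⟨y, hxy, fun γ hγ => Set.mem_iInter.1 hy ⟨γ, hγ⟩⟩
    choose g hg1 hg2 using hex
    let s : ℕ → K := fun n => g^[n] (g η)
    have hsucc : ∀ n, s (n + 1) = g (s n) := fun n => Function.iterate_succ_apply' g n _
    have hs : StrictMono s := strictMono_nat_of_lt_succ fun n => by rw [hsucc]; exact hg1 _
    obtain ⟨δ, h1, h2⟩ := exists_isLUB_of_strictMono (K := K) (by simp [aleph0_lt_mk]) hs
    refine ⟨δ, fun γ hγ => ?_, (hg1 η).trans (h1 0)⟩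
    obtain ⟨n, hn⟩ := h2 γ hγ
    refine (isClub_iff_acc.1 (hE γ)).1 δ ⟨⟨γ, hγ⟩, fun ξ hξ => ?_⟩
    obtain ⟨m, hm⟩ := h2 ξ hξ
    refine ⟨s (max n m + 1), ?_, ?_, h1 _⟩
    · rw [hsucc]
      exact hg2 _ _ (hn.le.trans (hs.monotone (le_max_left _ _)))
    · exact hm.trans (hs (Nat.lt_succ_of_le (le_max_right _ _)))

theorem isClub_closurePoints (f : K → K) : IsClub {δ | ∀ γ < δ, f γ < δ} :=
  isClub_diag (E := fun γ => Set.Ioi (f γ)) fun _ => isClub_Ioi _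

theorem isClub_acc_of_unbounded {T : Set K} (hT : ∀ η, ∃ x ∈ T, η < x) :
    IsClub {δ | Acc T δ} := by
  rw [isClub_iff_acc]
  constructor
  · intro δ hδ
    refine ⟨hδ.1, fun η hη => ?_⟩
    obtain ⟨x, hx, h1, h2⟩ := hδ.2 η hη
    obtain ⟨y, hy, h3, h4⟩ := hx.2 η h1
    exact ⟨y, hy, h3, h4.trans h2⟩
  · intro η
    choose f hf using hT
    obtain ⟨x, hx, hlt⟩ := (isClub_iff_acc.1 (isClub_closurePoints f)).2 η
    exact ⟨x, ⟨⟨η, hlt⟩, fun ξ hξ => ⟨f ξ, (hf ξ).1, (hf ξ).2, hx ξ hξ⟩⟩, hlt⟩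

theorem isClub_acc {E : Set K} (hE : IsClub E) : IsClub {δ | Acc E δ} :=
  isClub_acc_of_unbounded (isClub_iff_acc.1 hE).2

theorem isStationary_inter {S E : Set K} (hS : IsStationary S) (hE : IsClub E) :
    IsStationary (S ∩ E) := by
  intro F hF
  obtain ⟨x, hx⟩ := hS (isClub_inter hE hF)
  exact ⟨x, ⟨hx.1, hx.2.1⟩, hx.2.2⟩

/-- If all fibres were nonstationary, a point of `S` in the diagonal intersection of clubs avoiding
them would be missing from its own fibre. -/
theorem fodor {S : Set K} (hS : IsStationary S) {f : K → K} (hf : ∀ i ∈ S, f i < i) :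
    ∃ γ, IsStationary {i ∈ S | f i = γ} := by
  by_contra hcon
  push Not at hcon
  simp_rw [not_isStationary_iff] at hcon
  choose E hE hd using hcon
  obtain ⟨i, hi, hiE⟩ := hS (isClub_diag hE)
  exact Set.disjoint_left.1 (hd (f i)) ⟨hi, rfl⟩ (hiE _ (hf i hi))

theorem isStationary_Ioi_inter {S : Set K} (hS : IsStationary S) (a : K) :
    IsStationary (S ∩ Set.Ioi a) := isStationary_inter hS (isClub_Ioi a)

theorem IsStationary_unbounded {S : Set K} (hS : IsStationary S) (a : K) : ∃ i ∈ S, a < i := by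
  obtain ⟨i, h1, h2⟩ := hS (isClub_Ioi a)
  exact ⟨i, h1, h2⟩

/-- Suprema of increasing sequences of a given short length form a stationary set. -/
theorem isStationary_sup {ι : Type v} [LinearOrder ι] [WellFoundedLT ι] [NoMaxOrder ι]
    [Nonempty ι]
    (hι : Cardinal.lift.{u} #ι < Cardinal.lift.{v} #K) :
    IsStationary {δ : K | ∃ s : ι → K, StrictMono s ∧ (∀ i, s i < δ) ∧ ∀ η < δ, ∃ i, η < s i} := by
  intro E hE
  rw [isClub_iff_acc] at hE
  have hex : ∀ (i : ι) (f : Set.Iio i → K), ∃ x ∈ E, ∀ j, f j < x := by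
    intro i f
    obtain ⟨b, hb⟩ := bounded_lift f
      ((lift_le.2 (mk_set_le _)).trans_lt hι)
    obtain ⟨x, hx, hlt⟩ := hE.2 b
    exact ⟨x, hx, fun j => (hb j).trans hlt⟩
  choose g hgE hg using hex
  let s : ι → K := WellFoundedLT.fix (fun i f => g i fun j => f j.1 j.2)
  have hs : ∀ i, s i = g i fun j => s j.1 := fun i => WellFoundedLT.fix_eq _ i
  have hmono : StrictMono s := by
    intro i j hij
    rw [hs j]
    exact hg j (fun j' => s j'.1) ⟨i, hij⟩
  obtain ⟨δ, h1, h2⟩ := exists_isLUB_of_strictMono hι hmono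
  refine ⟨δ, ⟨s, hmono, h1, h2⟩, hE.1 δ (acc_of_isLUB (fun i => ?_) h1 h2)⟩
  rw [hs]; exact hgE _ _

end Clubs

end LargeRegular

/-! ### The forcing relation: equality, membership, canonical names, pairs -/

namespace SetForcing

section Basic

variable {P : Type u} [Preorder P]

theorem feq_mono {σ τ : PName P} {p q : P} (h : feq σ τ p) (hq : q ≤ p) : feq σ τ q := by
  cases σ; cases τ
  simp only [feq] at *
  exact ⟨fun i r hr => h.1 i r (hr.trans hq), fun i r hr => h.2 i r (hr.trans hq)⟩

theorem feq_of_dense {σ τ : PName P} {p : P} (h : ∀ q ≤ p, ∃ r ≤ q, feq σ τ r) : feq σ τ p := by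
  cases σ; cases τ
  simp only [feq] at *
  constructor
  · intro i q hq hqc
    obtain ⟨r, hr, h1, -⟩ := h q hq
    obtain ⟨s, hs, h2⟩ := h1 i r le_rfl (hr.trans hqc)
    exact ⟨s, hs.trans hr, h2⟩
  · intro i q hq hqc
    obtain ⟨r, hr, -, h1⟩ := h q hq
    obtain ⟨s, hs, h2⟩ := h1 i r le_rfl (hr.trans hqc)
    exact ⟨s, hs.trans hr, h2⟩

theorem feq_refl (σ : PName P) (p : P) : feq σ σ p := by
  induction σ generalizing p with
  | mk ι a c ih =>
    simp only [feq]
    exact ⟨fun i q _ hc => ⟨q, le_rfl, i, hc, ih i q⟩, fun i q _ hc => ⟨q, le_rfl, i, hc, ih i q⟩⟩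

theorem feq_symm {σ τ : PName P} {p : P} (h : feq σ τ p) : feq τ σ p := by
  induction σ generalizing τ p with
  | mk ι a c ih =>
    cases τ
    simp only [feq] at *
    constructor
    · intro i q hq hc
      obtain ⟨r, hr, j, hj, he⟩ := h.2 i q hq hc
      exact ⟨r, hr, j, hj, ih j he⟩
    · intro i q hq hc
      obtain ⟨r, hr, j, hj, he⟩ := h.1 i q hq hc
      exact ⟨r, hr, j, hj, ih i he⟩

theorem feq_trans {σ τ υ : PName P} {p : P} (h : feq σ τ p) (h' : feq τ υ p) : feq σ υ p := by
  induction σ generalizing τ υ p with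
  | mk ι a c ih =>
    cases τ; cases υ
    simp only [feq] at *
    constructor
    · intro i q hq hc
      obtain ⟨r, hr, j, hj, he⟩ := h.1 i q hq hc
      obtain ⟨s, hs, k, hk, he'⟩ := h'.1 j r (hr.trans hq) hj
      exact ⟨s, hs.trans hr, k, hk, ih i (feq_mono he hs) he'⟩
    · intro i q hq hc
      obtain ⟨r, hr, j, hj, he⟩ := h'.2 i q hq hc
      obtain ⟨s, hs, k, hk, he'⟩ := h.2 j r (hr.trans hq) hj
      exact ⟨s, hs.trans hr, k, hk, ih k he' (feq_mono he hs)⟩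

theorem fmem_mono {σ τ : PName P} {p q : P} (h : fmem σ τ p) (hq : q ≤ p) : fmem σ τ q := by
  cases τ
  simp only [fmem] at *
  exact fun r hr => h r (hr.trans hq)

theorem fmem_of_dense {σ τ : PName P} {p : P} (h : ∀ q ≤ p, ∃ r ≤ q, fmem σ τ r) :
    fmem σ τ p := by
  cases τ
  simp only [fmem] at *
  intro q hq
  obtain ⟨r, hr, h1⟩ := h q hq
  obtain ⟨s, hs, h2⟩ := h1 r le_rfl
  exact ⟨s, hs.trans hr, h2⟩

theorem fmem_congr_left {σ σ' τ : PName P} {p : P} (h : feq σ σ' p) (hm : fmem σ τ p) :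
    fmem σ' τ p := by
  cases τ
  simp only [fmem] at *
  intro q hq
  obtain ⟨r, hr, j, hj, he⟩ := hm q hq
  exact ⟨r, hr, j, hj, feq_trans (feq_symm (feq_mono h (hr.trans hq))) he⟩

theorem fmem_congr_right {σ τ τ' : PName P} {p : P} (h : feq τ τ' p) (hm : fmem σ τ p) :
    fmem σ τ' p := by
  cases τ; cases τ'
  simp only [fmem, feq] at *
  intro q hq
  obtain ⟨r, hr, j, hj, he⟩ := hm q hq
  obtain ⟨s, hs, k, hk, he'⟩ := h.1 j r (hr.trans hq) hj
  exact ⟨s, hs.trans hr, k, hk, feq_trans (feq_mono he hs) he'⟩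

theorem fmem_mk {ι : Type u} {a : ι → PName P} {c : ι → P} (i : ι) {p : P} (hp : p ≤ c i) :
    fmem (a i) (PName.mk ι a c) p := by
  simp only [fmem]
  exact fun q hq => ⟨q, le_rfl, i, hq.trans hp, feq_refl _ _⟩

theorem exists_of_fmem_mk {ι : Type u} {a : ι → PName P} {c : ι → P} {σ : PName P} {p : P}
    (h : fmem σ (PName.mk ι a c) p) : ∃ r ≤ p, ∃ i, r ≤ c i ∧ feq σ (a i) r := by
  simp only [fmem] at h
  exact h p le_rfl

theorem feq_of_forall_mem {σ τ : PName P} {p : P}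
    (h1 : ∀ y, ∀ q ≤ p, fmem y σ q → fmem y τ q) (h2 : ∀ y, ∀ q ≤ p, fmem y τ q → fmem y σ q) :
    feq σ τ p := by
  obtain ⟨ι, a, c⟩ := σ
  obtain ⟨κ, b, d⟩ := τ
  rw [feq]
  constructor
  · intro i q hq hc
    exact exists_of_fmem_mk (h1 (a i) q hq (fmem_mk i hc))
  · intro i q hq hc
    obtain ⟨r, hr, j, hj, he⟩ := exists_of_fmem_mk (h2 (b i) q hq (fmem_mk i hc))
    exact ⟨r, hr, j, hj, feq_symm he⟩

/-! ### Canonical names -/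

theorem fmem_check_func (x : PSet.{u}) (i : x.Type) (p : P) :
    fmem (PName.check (x.Func i)) (PName.check x) p := by
  obtain ⟨ι, A⟩ := x
  exact fmem_mk (a := fun i : ι × P => PName.check (A i.1)) (c := fun i => i.2) (i, p) le_rfl

theorem exists_of_fmem_check {σ : PName P} {x : PSet.{u}} {p : P} (h : fmem σ (PName.check x) p) :
    ∃ r ≤ p, ∃ i : x.Type, feq σ (PName.check (x.Func i)) r := by
  cases x
  obtain ⟨r, hr, i, -, he⟩ := exists_of_fmem_mk h
  exact ⟨r, hr, i.1, he⟩

theorem feq_check_of_equiv {x y : PSet.{u}} (h : x.Equiv y) (p : P) :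
    feq (PName.check x) (PName.check y) p := by
  induction x generalizing y p with
  | mk ι A ih =>
    cases y
    simp only [PName.check, feq]
    obtain ⟨h1, h2⟩ := h
    constructor
    · intro i q _ _
      obtain ⟨j, hj⟩ := h1 i.1
      exact ⟨q, le_rfl, ⟨j, q⟩, le_rfl, ih _ hj q⟩
    · intro i q _ _
      obtain ⟨j, hj⟩ := h2 i.1
      exact ⟨q, le_rfl, ⟨j, q⟩, le_rfl, ih _ hj q⟩

theorem equiv_of_feq_check {x y : PSet.{u}} {p : P}
    (h : feq (PName.check x) (PName.check y) p) : x.Equiv y := by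
  induction x generalizing y p with
  | mk ι A ih =>
    cases y
    simp only [PName.check, feq] at h
    constructor
    · intro i
      obtain ⟨r, -, j, -, he⟩ := h.1 ⟨i, p⟩ p le_rfl le_rfl
      exact ⟨j.1, ih _ he⟩
    · intro i
      obtain ⟨r, -, j, -, he⟩ := h.2 ⟨i, p⟩ p le_rfl le_rfl
      exact ⟨j.1, ih _ he⟩

/-- The canonical name of an ordinal. -/
noncomputable abbrev ordName (P : Type u) (o : Ordinal.{u}) : PName P := PName.check o.toPSet

theorem fmem_ordName {a b : Ordinal.{u}} (h : a < b) (p : P) :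
    fmem (ordName P a) (ordName P b) p := by
  obtain ⟨i, hi⟩ : a.toPSet ∈ b.toPSet := Ordinal.mem_toPSet_iff.2 ⟨a, h, PSet.Equiv.refl _⟩
  exact fmem_congr_left (feq_symm (feq_check_of_equiv hi p)) (fmem_check_func _ i p)

theorem exists_of_fmem_ordName {σ : PName P} {o : Ordinal.{u}} {p : P}
    (h : fmem σ (ordName P o) p) : ∃ r ≤ p, ∃ a < o, feq σ (ordName P a) r := by
  obtain ⟨r, hr, i, he⟩ := exists_of_fmem_check h
  obtain ⟨a, ha, hia⟩ := Ordinal.mem_toPSet_iff.1 (PSet.func_mem o.toPSet i)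
  exact ⟨r, hr, a, ha, feq_trans he (feq_check_of_equiv hia r)⟩

theorem eq_of_feq_ordName {a b : Ordinal.{u}} {p : P} (h : feq (ordName P a) (ordName P b) p) :
    a = b := by
  have := PSet.rank_congr (equiv_of_feq_check h)
  simpa using this

theorem lt_of_fmem_ordName {a b : Ordinal.{u}} {p : P} (h : fmem (ordName P a) (ordName P b) p) :
    a < b := by
  obtain ⟨r, -, c, hc, he⟩ := exists_of_fmem_ordName h
  rwa [eq_of_feq_ordName he]

/-! ### Ordered pairs -/

theorem fmem_upair_left (a b : PName P) (p : P) : fmem a (PName.upair a b) p :=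
  fmem_mk (a := fun i : ULift.{u} Bool × P => cond i.1.down a b) ⟨⟨true⟩, p⟩ le_rfl

theorem fmem_upair_right (a b : PName P) (p : P) : fmem b (PName.upair a b) p :=
  fmem_mk (a := fun i : ULift.{u} Bool × P => cond i.1.down a b) ⟨⟨false⟩, p⟩ le_rfl

theorem exists_of_fmem_upair {x a b : PName P} {p : P} (h : fmem x (PName.upair a b) p) :
    ∃ r ≤ p, feq x a r ∨ feq x b r := by
  obtain ⟨r, hr, ⟨⟨_ | _⟩, _⟩, -, he⟩ := exists_of_fmem_mk h
  · exact ⟨r, hr, Or.inr he⟩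
  · exact ⟨r, hr, Or.inl he⟩

theorem fmem_upair_of_dense {x a b : PName P} {p : P}
    (h : ∀ q ≤ p, ∃ r ≤ q, feq x a r ∨ feq x b r) : fmem x (PName.upair a b) p := by
  refine fmem_of_dense fun q hq => ?_
  obtain ⟨r, hr, h | h⟩ := h q hq
  · exact ⟨r, hr, fmem_congr_left (feq_symm h) (fmem_upair_left a b r)⟩
  · exact ⟨r, hr, fmem_congr_left (feq_symm h) (fmem_upair_right a b r)⟩

theorem fmem_upair_congr {x a b a' b' : PName P} {p : P} (ha : feq a a' p) (hb : feq b b' p)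
    (h : fmem x (PName.upair a b) p) : fmem x (PName.upair a' b') p := by
  refine fmem_upair_of_dense fun q hq => ?_
  obtain ⟨r, hr, h | h⟩ := exists_of_fmem_upair (fmem_mono h hq)
  · exact ⟨r, hr, Or.inl (feq_trans h (feq_mono ha (hr.trans hq)))⟩
  · exact ⟨r, hr, Or.inr (feq_trans h (feq_mono hb (hr.trans hq)))⟩

theorem feq_upair {a b a' b' : PName P} {p : P} (ha : feq a a' p) (hb : feq b b' p) :
    feq (PName.upair a b) (PName.upair a' b') p :=
  feq_of_forall_mem
    (fun _ _ hq h => fmem_upair_congr (feq_mono ha hq) (feq_mono hb hq) h)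
    (fun _ _ hq h => fmem_upair_congr (feq_symm (feq_mono ha hq)) (feq_symm (feq_mono hb hq)) h)

theorem feq_opair {a b a' b' : PName P} {p : P} (ha : feq a a' p) (hb : feq b b' p) :
    feq (PName.opair a b) (PName.opair a' b') p :=
  feq_upair (feq_upair ha ha) (feq_upair ha hb)

theorem feq_of_feq_upair_self {a c d : PName P} {p : P}
    (h : feq (PName.upair a a) (PName.upair c d) p) : feq a c p ∧ feq a d p := by
  constructor
  · refine feq_of_dense fun q hq => ?_
    obtain ⟨r, hr, h | h⟩ := exists_of_fmem_upair
      (fmem_congr_right (feq_symm (feq_mono h hq)) (fmem_upair_left c d q)) <;>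
    exact ⟨r, hr, feq_symm h⟩
  · refine feq_of_dense fun q hq => ?_
    obtain ⟨r, hr, h | h⟩ := exists_of_fmem_upair
      (fmem_congr_right (feq_symm (feq_mono h hq)) (fmem_upair_right c d q)) <;>
    exact ⟨r, hr, feq_symm h⟩

theorem feq_fst_of_feq_opair {a b c d : PName P} {p : P}
    (h : feq (PName.opair a b) (PName.opair c d) p) : feq a c p := by
  refine feq_of_dense fun q hq => ?_
  obtain ⟨r, hr, h | h⟩ := exists_of_fmem_upair
    (fmem_congr_right (feq_mono h hq) (fmem_upair_left (PName.upair a a) (PName.upair a b) q))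
  · exact ⟨r, hr, (feq_of_feq_upair_self h).1⟩
  · exact ⟨r, hr, (feq_of_feq_upair_self h).1⟩

/-- Kuratowski's case analysis. Each disjunction is decided only by a stronger condition, so the
equality is obtained densely below `p`. -/
theorem feq_snd_of_feq_opair {a b c d : PName P} {p : P}
    (h : feq (PName.opair a b) (PName.opair c d) p) : feq b d p := by
  refine feq_of_dense fun q hq => ?_
  have hac := feq_mono (feq_fst_of_feq_opair h) hq
  obtain ⟨r, hr, h1⟩ := exists_of_fmem_upair
    (fmem_congr_right (feq_mono h hq) (fmem_upair_right (PName.upair a a) (PName.upair a b) q))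
  obtain ⟨s, hs, h2⟩ := exists_of_fmem_upair
    (fmem_congr_right (feq_symm (feq_mono h (hr.trans hq)))
      (fmem_upair_right (PName.upair c c) (PName.upair c d) r))
  have hac := feq_mono hac (hs.trans hr)
  have key : ∃ t ≤ s, feq b d t := by
    rcases h2 with h2 | h2
    · have hda := (feq_of_feq_upair_self (feq_symm h2)).2
      rcases h1 with h1 | h1
      · have hb := (feq_of_feq_upair_self (feq_symm (feq_mono h1 hs))).2
        exact ⟨s, le_rfl, feq_trans (feq_symm hb) (feq_trans (feq_symm hac) hda)⟩
      · obtain ⟨t, ht, h3 | h3⟩ := exists_of_fmem_upair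
          (fmem_congr_right (feq_mono h1 hs) (fmem_upair_right a b s))
        · exact ⟨t, ht, feq_trans h3 (feq_mono (feq_trans (feq_symm hac) hda) ht)⟩
        · exact ⟨t, ht, h3⟩
    · obtain ⟨t, ht, h3 | h3⟩ := exists_of_fmem_upair
        (fmem_congr_right h2 (fmem_upair_right c d s))
      · obtain ⟨w, hw, h4 | h4⟩ := exists_of_fmem_upair
          (fmem_congr_right (feq_symm (feq_mono h2 ht)) (fmem_upair_right a b t))
        · exact ⟨w, hw.trans ht, feq_trans h4 (feq_trans
            (feq_symm (feq_mono hac (hw.trans ht))) (feq_symm (feq_mono h3 hw)))⟩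
        · exact ⟨w, hw.trans ht, h4⟩
      · exact ⟨t, ht, feq_symm h3⟩
  obtain ⟨t, ht, he⟩ := key
  exact ⟨t, ht.trans (hs.trans hr), he⟩

end Basic

end SetForcing

/-! ### Stationary preservation from hits; small sets from distributivity -/

namespace SetForcing

open LargeRegular

section Preservation

variable {P : Type u} [Preorder P]

/-- For every strategy `ext` of extending conditions and every stationary set `S`, there is a
condition whose height lies in `S` and below which the strategy has been followed cofinally
often. -/
def Hits {K : Type u} [LinearOrder K] [WellFoundedLT K] (ht : P → K) : Prop :=
  ∀ (p : P) (ext : P → P), (∀ c, ext c ≤ c) → ∀ S : Set K, IsStationary S →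
    ∃ i ∈ S, ∃ q ≤ p, ∀ η < i, ∃ c ≤ p, q ≤ ext c ∧ η < ht c ∧ ht (ext c) < i

/-- The intersection of fewer than `κ` open dense sets is dense. -/
def Distributive (P : Type u) [Preorder P] (κ : Cardinal.{u}) : Prop :=
  ∀ (ι : Type u), #ι < κ → ∀ D : ι → Set P, (∀ i p, ∃ q ≤ p, q ∈ D i) →
    (∀ i p q, q ≤ p → p ∈ D i → q ∈ D i) → ∀ p, ∃ q ≤ p, ∀ i, q ∈ D i

theorem ordinalSet_func {κ : Cardinal.{u}} {S : Set κ.ord.ToType} {i : κ.ord.ToType} (hi : i ∈ S)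
    (p : P) : fmem (ordName P (Ordinal.ToType.toOrd i)) (PName.check (ordinalSet S)) p :=
  fmem_check_func (ordinalSet S) (⟨i, hi⟩ : S) p

/-- The strategy forces into `C` an ordinal between the heights of a condition and of its extension.
A hit at `i` then forces `C` to be cofinal in `i`, hence `i ∈ C`. -/
theorem preservesStationary_of_hits {κ : Cardinal.{u}} [LargeRegular κ.ord.ToType]
    (ht : P → κ.ord.ToType) (hcof : ∀ p ξ, ∃ q ≤ p, ξ < ht q) (hhit : Hits ht) :
    PreservesStationary P κ := by
  intro S hS p C q hqp hC
  have hstep : ∀ c : P, ∃ c' ≤ c, c ≤ q → ∃ γ, ht c < γ ∧ γ < ht c' ∧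
      fmem (ordName P (Ordinal.ToType.toOrd γ)) C c' := by
    intro c
    by_cases hc : c ≤ q
    swap
    · exact ⟨c, le_rfl, fun h => absurd h hc⟩
    obtain ⟨h1, h2, -⟩ := hC
    obtain ⟨r, hr, hb⟩ := h2 (ordName P (Ordinal.ToType.toOrd (ht c))) c hc
      (fmem_ordName (Ordinal.ToType.toOrd (ht c)).2 c)
    obtain ⟨s, hs, b, hbC, hlt⟩ := hb r le_rfl
    obtain ⟨t, hts, hbk⟩ := h1 b s (hs.trans (hr.trans hc)) hbC
    obtain ⟨w, hw, γ, hγ, he⟩ := exists_of_fmem_ordName hbk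
    obtain ⟨z, hz, hzh⟩ := hcof w (Ordinal.ToType.mk ⟨γ, hγ⟩)
    refine ⟨z, hz.trans (hw.trans (hts.trans (hs.trans hr))), fun _ =>
      ⟨Ordinal.ToType.mk ⟨γ, hγ⟩, ?_, hzh, ?_⟩⟩
    · have h3 := lt_of_fmem_ordName (fmem_congr_right he (fmem_mono hlt (hw.trans hts)))
      rw [← Ordinal.ToType.mk.symm.lt_iff_lt, OrderIso.symm_apply_apply]
      exact h3
    · have h3 := fmem_congr_left (feq_mono he hz) (fmem_mono hbC (hz.trans (hw.trans hts)))
      simpa using h3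
  choose ext hext hγ using hstep
  obtain ⟨a⟩ : Nonempty κ.ord.ToType := inferInstance
  -- An `i` above some `a` is not zero, as the closure clause of `fclub` requires.
  obtain ⟨i, ⟨hiS, hai⟩, r, hrq, hr⟩ := hhit q ext hext _ (isStationary_Ioi_inter hS a)
  have hclosed := hC.2.2 (ordName P (Ordinal.ToType.toOrd i)) r hrq
    (fmem_ordName (Ordinal.ToType.toOrd i).2 r)
  obtain ⟨s, hs, himp⟩ := hclosed
  obtain ⟨t, hts, hmem⟩ := himp s le_rfl (by
    refine ⟨fun w _ => ⟨w, le_rfl, ordName P (Ordinal.ToType.toOrd a), fmem_ordName ?_ w⟩, ?_⟩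
    · exact Ordinal.ToType.mk.symm.lt_iff_lt.2 hai
    · intro y w hw hy
      obtain ⟨z, hz, b, hb, he⟩ := exists_of_fmem_ordName hy
      have hbκ : b < κ.ord := hb.trans (Ordinal.ToType.toOrd i).2
      obtain ⟨c, hcq, hrc, hbc, hci⟩ := hr (Ordinal.ToType.mk ⟨b, hbκ⟩) (by
        rw [← Ordinal.ToType.mk.symm.lt_iff_lt, OrderIso.symm_apply_apply]; exact hb)
      obtain ⟨γ, h1, h2, h3⟩ := hγ c hcq
      have hzr : z ≤ r := hz.trans (hw.trans hs)
      refine ⟨z, hz, fun z' hz' => ⟨z', le_rfl, _, fmem_mono h3 (hz'.trans (hzr.trans hrc)), ?_, ?_⟩⟩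
      · refine fmem_congr_left (feq_symm (feq_mono he hz')) (fmem_ordName ?_ z')
        have := Ordinal.ToType.mk.symm.lt_iff_lt.2 (hbc.trans h1)
        rw [OrderIso.symm_apply_apply] at this
        exact this
      · exact fmem_ordName (Ordinal.ToType.mk.symm.lt_iff_lt.2 (h2.trans hci)) z')
  exact ⟨t, hts.trans (hs.trans hrq), fun w hw => ⟨w, le_rfl, _, fmem_mono hmem hw,
    ordinalSet_func hiS w⟩⟩

/-- By distributivity one condition decides all values of an enumeration of `x` in fewer than `κ`
steps; the set of these values lies in the ground model and equals `x`. -/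
theorem addsNoSmallSets_of_distributive {κ : Cardinal.{u}} (hdist : Distributive P κ) :
    AddsNoSmallSets P κ := by
  intro p x q hqp hx
  obtain ⟨hground, hcard⟩ := hx
  obtain ⟨r₁, hr₁, a, hak, hf⟩ := hcard q le_rfl
  obtain ⟨r₂, hr₂, f, hbij⟩ := hf r₁ le_rfl
  obtain ⟨r, hr, α, hα, haα⟩ := exists_of_fmem_ordName (fmem_mono hak hr₂)
  have hrq : r ≤ q := hr.trans (hr₂.trans hr₁)
  obtain ⟨-, htotal, hsurj⟩ := hbij
  have hval : ∀ β : α.ToType, ∀ s ≤ r, ∃ t ≤ s, ∃ z : PSet.{u},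
      fmem (PName.opair (ordName P (Ordinal.ToType.toOrd β)) (PName.check z)) f t ∧
      fmem (PName.check z) x t := by
    intro β s hs
    obtain ⟨t, hts, ht⟩ := htotal (ordName P (Ordinal.ToType.toOrd β)) s (hs.trans hr)
      (fmem_congr_right (feq_symm (feq_mono haα hs)) (fmem_ordName (Ordinal.ToType.toOrd β).2 s))
    obtain ⟨w, hw, b, hbx, hbf, -⟩ := ht t le_rfl
    obtain ⟨y, hyw, hy⟩ := hground b w (hw.trans (hts.trans (hs.trans hrq))) hbx
    obtain ⟨v, hv, z, hz⟩ := hy y le_rfl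
    have hvw := hv.trans hyw
    refine ⟨v, hvw.trans (hw.trans hts), z, ?_, ?_⟩
    · exact fmem_congr_left (feq_opair (feq_refl _ _) hz) (fmem_mono hbf hvw)
    · exact fmem_congr_left hz (fmem_mono hbx hvw)
  obtain ⟨s, hsr, hs⟩ := hdist α.ToType (by
      rw [mk_toType]; exact lt_ord.1 hα)
    -- The second alternative admits the conditions incompatible with `r`, so that the sets are
    -- dense everywhere and not only below `r`.
    (fun β => {t | (∃ z : PSet.{u},
      fmem (PName.opair (ordName P (Ordinal.ToType.toOrd β)) (PName.check z)) f t ∧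
      fmem (PName.check z) x t) ∨ ∀ t' ≤ t, ¬ t' ≤ r})
    (by
      intro β t
      by_cases h : ∃ t' ≤ t, t' ≤ r
      · obtain ⟨t', h1, h2⟩ := h
        obtain ⟨w, hw, hz⟩ := hval β t' h2
        exact ⟨w, hw.trans h1, Or.inl hz⟩
      · push Not at h
        exact ⟨t, le_rfl, Or.inr h⟩)
    (by
      rintro β t t' htt (⟨z, h1, h2⟩ | h)
      · exact Or.inl ⟨z, fmem_mono h1 htt, fmem_mono h2 htt⟩
      · exact Or.inr fun w hw => h w (hw.trans htt)) r
  have hs' : ∀ β : α.ToType, ∃ z : PSet.{u},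
      fmem (PName.opair (ordName P (Ordinal.ToType.toOrd β)) (PName.check z)) f s ∧
      fmem (PName.check z) x s := fun β => (hs β).resolve_right fun h => h s le_rfl hsr
  choose z hzf hzx using hs'
  refine ⟨s, hsr.trans hrq, fun t hts => ⟨t, le_rfl, ⟨α.ToType, z⟩, ?_⟩⟩
  refine feq_of_forall_mem ?_ ?_
  · intro y w hw hy
    refine fmem_of_dense fun w' hw' => ?_
    have hw's : w' ≤ s := hw'.trans (hw.trans hts)
    obtain ⟨v, hv, hv'⟩ := hsurj y w' (hw's.trans (hsr.trans hr)) (fmem_mono hy hw')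
    obtain ⟨v₁, hv₁, a', ha', hpair, -⟩ := hv' v le_rfl
    have hv₁s : v₁ ≤ s := hv₁.trans (hv.trans hw's)
    obtain ⟨v₂, hv₂, β, hβ, heβ⟩ := exists_of_fmem_ordName
      (fmem_congr_right (feq_mono haα (hv₁s.trans hsr)) ha')
    have hv₂s := hv₂.trans hv₁s
    let B : α.ToType := Ordinal.ToType.mk ⟨β, hβ⟩
    have hB : (Ordinal.ToType.toOrd B : Ordinal) = β := by simp [B]
    obtain ⟨v₃, hv₃, h3⟩ := htotal a' v₂ (hv₂s.trans (hsr.trans hr)) (fmem_mono ha' hv₂)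
    obtain ⟨v₄, hv₄, b, hbx, hbf, huniq⟩ := h3 v₃ le_rfl
    have hv₄₂ : v₄ ≤ v₂ := hv₄.trans hv₃
    have hpB : fmem (PName.opair a' (PName.check (z B))) f v₄ := by
      refine fmem_congr_left (feq_opair (feq_symm (feq_mono heβ hv₄₂)) (feq_refl _ _)) ?_
      have := fmem_mono (hzf B) (hv₄₂.trans hv₂s)
      rwa [hB] at this
    obtain ⟨v₅, hv₅, h5⟩ := huniq y v₄ le_rfl
      (fmem_mono hy (hv₄₂.trans (hv₂.trans (hv₁.trans (hv.trans hw')))))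
    obtain ⟨v₆, hv₆, h6⟩ := h5 v₅ le_rfl (fmem_mono hpair (hv₅.trans (hv₄₂.trans hv₂)))
    have hv₆₄ := hv₆.trans hv₅
    obtain ⟨v₇, hv₇, h7⟩ := huniq (PName.check (z B)) v₆ hv₆₄
      (fmem_mono (hzx B) (hv₆₄.trans (hv₄₂.trans hv₂s)))
    obtain ⟨v₈, hv₈, h8⟩ := h7 v₇ le_rfl (fmem_mono hpB (hv₇.trans hv₆₄))
    have hv₈₆ := hv₈.trans hv₇
    refine ⟨v₈, hv₈₆.trans (hv₆₄.trans (hv₄₂.trans (hv₂.trans (hv₁.trans hv)))), ?_⟩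
    exact fmem_congr_left (feq_trans h8 (feq_symm (feq_mono h6 hv₈₆)))
      (fmem_check_func ⟨α.ToType, z⟩ B v₈)
  · intro y w hw hy
    refine fmem_of_dense fun w' hw' => ?_
    obtain ⟨v, hv, B, hB⟩ := exists_of_fmem_check (fmem_mono hy hw')
    exact ⟨v, hv, fmem_congr_left (feq_symm hB)
      (fmem_mono (hzx B) (hv.trans (hw'.trans (hw.trans hts))))⟩

end Preservation

end SetForcing

/-! ### Distributivity from hits -/

namespace SetForcing

open LargeRegular

/-- Through `s`, the point `i` inherits the cofinality of `W`. -/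
theorem exists_lt_forall_lt_of_strictMono {K W : Type u} [LinearOrder K] [LinearOrder W]
    {s : W → K} (hs : StrictMono s) {i : K} (h1 : ∀ w, s w < i)
    (h2 : ∀ η < i, ∃ w, η < s w) {J : Type u} (hJ : #J < Order.cof W) (f : J → K)
    (hf : ∀ j, f j < i) : ∃ η < i, ∀ j, f j < η := by
  choose g hg using fun j => h2 (f j) (hf j)
  have h : ¬ IsCofinal (Set.range g) := fun h =>
    absurd ((Order.cof_le h).trans mk_range_le) (not_le.2 hJ)
  obtain ⟨w, hw⟩ := not_isCofinal_iff.1 h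
  exact ⟨s w, h1 w, fun j => (hg j).trans (hs (hw _ ⟨j, rfl⟩))⟩

section Distributivity

variable {P : Type u} [Preorder P]

theorem exists_le_of_finite {ι : Type u} [Finite ι] {D : ι → Set P}
    (hd : ∀ i p, ∃ q ≤ p, q ∈ D i) (ho : ∀ i p q, q ≤ p → p ∈ D i → q ∈ D i) (p : P) :
    ∃ q ≤ p, ∀ i, q ∈ D i := by
  have key : ∀ s : Set ι, s.Finite → ∃ q ≤ p, ∀ i ∈ s, q ∈ D i := by
    intro s hs
    induction s, hs using Set.Finite.induction_on with
    | empty => exact ⟨p, le_rfl, by simp⟩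
    | insert _ _ ih =>
      obtain ⟨q, hq, h⟩ := ih
      rename_i a s _ _
      obtain ⟨r, hr, h'⟩ := hd a q
      refine ⟨r, hr.trans hq, fun i hi => ?_⟩
      rcases hi with rfl | hi
      · exact h'
      · exact ho _ _ _ hr (h i hi)
  obtain ⟨q, hq, h⟩ := key Set.univ Set.finite_univ
  exact ⟨q, hq, fun i => h i trivial⟩

/-- Induction on the number of dense sets. In the regular case the strategy enters the first dense
set not yet met, and a hit is taken at some `i` whose cofinality is that number. -/
theorem distributive_of_hits {K : Type u} [LinearOrder K] [WellFoundedLT K] [LargeRegular K]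
    {ht : P → K} (hlin : ∀ a b q, q ≤ a → q ≤ b → ht a ≤ ht b → b ≤ a) (hhit : Hits ht) :
    Distributive P #K := by
  intro ι hι D hd ho p
  induction hμ : #ι using WellFoundedLT.induction generalizing ι p with
  | ind μ ih =>
  rcases finite_or_infinite ι with hfin | hinf
  · exact exists_le_of_finite hd ho p
  have hW0 : #((#ι).ord.ToType) = #ι := mk_ord_toType _
  obtain ⟨e⟩ := Cardinal.eq.1 hW0
  have : Infinite (#ι).ord.ToType := e.infinite_iff.2 hinf
  generalize hWdef : (#ι).ord.ToType = W at *
  have hIio : ∀ w : (#ι).ord.ToType, #(Set.Iio w) < #ι := fun w => by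
    simpa using mk_Iio_lt w (by simp)
  have hnm : NoMaxOrder (#ι).ord.ToType := noMaxOrder (aleph0_le_mk ι)
  subst hWdef
  suffices ∃ q ≤ p, ∀ w, q ∈ D (e w) by
    obtain ⟨q, hq, h⟩ := this
    exact ⟨q, hq, fun i => by simpa using h (e.symm i)⟩
  -- If `#ι` is singular, group the dense sets into initial segments along a short cofinal set; both
  -- the groups and their number are covered by induction.
  by_cases hcof : Order.cof (#ι).ord.ToType < #ι
  · obtain ⟨s, hs, hsc⟩ := Order.exists_cof_eq (#ι).ord.ToType
    have hE : ∀ (w : (#ι).ord.ToType) (p : P), ∃ q ≤ p, ∀ v : Set.Iio w, q ∈ D (e v) := by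
      intro w p
      exact ih _ (hμ ▸ hIio w) (Set.Iio w) ((hIio w).trans hι) (D := fun v => D (e v))
        (fun v => hd _) (fun v => ho _) p rfl
    obtain ⟨q, hq, h⟩ := ih #s (by rw [hsc, ← hμ]; exact hcof) s (by rw [hsc]; exact hcof.trans hι)
      (D := fun w => {q | ∀ v : Set.Iio w.1, q ∈ D (e v)}) (fun w => hE w)
      (fun w a b hab ha v => ho _ _ _ hab (ha v)) p rfl
    refine ⟨q, hq, fun w => ?_⟩
    obtain ⟨w', hw'⟩ := exists_gt w
    obtain ⟨x, hx, hwx⟩ := hs w'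
    exact h ⟨x, hx⟩ ⟨w, hw'.trans_le hwx⟩
  · have hcof' : ∀ w : (#ι).ord.ToType, #(Set.Iio w) < Order.cof (#ι).ord.ToType := fun w =>
      (hIio w).trans_le (not_lt.1 hcof)
    have hext : ∀ c : P, ∃ c' ≤ c, ∀ w : (#ι).ord.ToType,
        (∀ v < w, c ∈ D (e v)) → c' ∈ D (e w) := by
      intro c
      by_cases h : ∃ w, c ∉ D (e w)
      · let w := wellFounded_lt.min {w | c ∉ D (e w)} h
        obtain ⟨c', hc', hw⟩ := hd (e w) c
        refine ⟨c', hc', fun v hv => ?_⟩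
        rcases lt_trichotomy v w with hvw | hvw | hvw
        · by_contra hv'
          exact wellFounded_lt.not_lt_min {w | c ∉ D (e w)}
            (fun hc => hv' (ho _ _ _ hc' hc)) hvw
        · rwa [hvw]
        · exact absurd (hv w hvw) (wellFounded_lt.min_mem {w | c ∉ D (e w)} h)
      · push Not at h
        exact ⟨c, le_rfl, fun w _ => h w⟩
    choose ext hext hextD using hext
    obtain ⟨i, ⟨s, hs, hsi, hsc⟩, q, hqp, hq⟩ := hhit p ext hext _
      (isStationary_sup (K := K) (ι := (#ι).ord.ToType) (by simpa using hι))
    -- Fewer than `cof i` earlier sets are entered below a common height `ξ < i`; the next move made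
    -- above `ξ` enters the set of index `w`.
    have key : ∀ w, ∃ η < i, ∀ c ≤ p, q ≤ c → η ≤ ht c → c ∈ D (e w) := by
      intro w
      induction w using WellFoundedLT.induction with
      | ind w ihw =>
      have ihw' : ∀ v : Set.Iio w, ∃ η < i, ∀ c ≤ p, q ≤ c → η ≤ ht c → c ∈ D (e v) :=
        fun v => ihw v.1 v.2
      choose η hηi hη using ihw'
      obtain ⟨ξ, hξ, hηξ⟩ := exists_lt_forall_lt_of_strictMono hs hsi hsc (hcof' w) η hηi
      obtain ⟨c, hcp, hqc, hξc, hci⟩ := hq ξ hξ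
      refine ⟨ht (ext c), hci, fun c' hc' hqc' hle => ?_⟩
      refine ho _ _ _ (hlin _ _ _ hqc hqc' hle) (hextD c w fun v hv => ?_)
      exact hη ⟨v, hv⟩ c hcp (hqc.trans (hext c)) ((hηξ ⟨v, hv⟩).trans hξc).le
    refine ⟨q, hqp, fun w => ?_⟩
    obtain ⟨η, hηi, hη⟩ := key w
    obtain ⟨c, hcp, hqc, hηc, -⟩ := hq η hηi
    exact ho _ _ _ (hqc.trans (hext c)) (hη c hcp (hqc.trans (hext c)) hηc.le)

end Distributivity

end SetForcing

/-! ### Levels of the tree and the generic branch -/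

namespace SetForcing

section Level

variable {T : Type u} [PartialOrder T] [WellFoundedLT T]

/-- The level of an element of a well-founded tree. -/
noncomputable def level (t : T) : Ordinal.{u} := IsWellFounded.rank (· < ·) t

theorem level_lt {s t : T} (h : s < t) : level s < level t := IsWellFounded.rank_lt_of_rel h

theorem exists_level_eq {t : T} {a : Ordinal.{u}} (h : a ≤ level t) : ∃ s ≤ t, level s = a := by
  induction t using WellFoundedLT.induction with
  | ind t ih =>
  rcases h.lt_or_eq with h | h
  · rw [level, IsWellFounded.rank_eq, Ordinal.lt_iSup_iff] at h
    obtain ⟨⟨b, hb⟩, hab⟩ := h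
    obtain ⟨s, hs, hsa⟩ := ih b hb (lt_succ_iff.1 hab)
    exact ⟨s, hs.trans (le_of_lt hb), hsa⟩
  · exact ⟨t, le_rfl, h.symm⟩

theorem level_le_typein {K : Type u} [LinearOrder K] [WellFoundedLT K] {ht : T → K}
    (hmono : StrictMono ht) (t : T) : level t ≤ Ordinal.typein (α := K) (· < ·) (ht t) := by
  induction t using WellFoundedLT.induction with
  | ind t ih =>
  rw [level, IsWellFounded.rank_eq]
  refine Ordinal.iSup_le fun b => succ_le_of_lt ((ih b.1 b.2).trans_lt ?_)
  exact (Ordinal.typein_lt_typein (α := K) (· < ·)).2 (hmono b.2)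

theorem level_lt_ord {κ : Cardinal.{u}} {ht : T → κ.ord.ToType} (hmono : StrictMono ht) (t : T) :
    level t < κ.ord := by
  exact (level_le_typein hmono t).trans_lt (Ordinal.typein_lt_self (ht t))

/-- By induction the conditions of level at least `β` are dense for each `β < a`; distributivity
meets all these sets at once. -/
theorem exists_le_level {κ : Cardinal.{u}} (hdist : Distributive Tᵒᵈ κ)
    (hgt : ∀ t : T, ∃ t', t < t') {a : Ordinal.{u}} (ha : a < κ.ord) (t : T) :
    ∃ t' ≥ t, a ≤ level t' := by
  induction a using WellFoundedLT.induction generalizing t with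
  | ind a ih =>
  obtain ⟨q, hq, h⟩ := hdist a.ToType (by rw [mk_toType]; exact lt_ord.1 ha)
    (fun β => {q | (Ordinal.ToType.toOrd β : Ordinal) ≤ level (OrderDual.ofDual q)})
    (fun β p => by
      have hβ : (Ordinal.ToType.toOrd β : Ordinal) < a := (Ordinal.ToType.toOrd β).2
      obtain ⟨t', h1, h2⟩ := ih _ hβ (hβ.trans ha) (OrderDual.ofDual p)
      exact ⟨OrderDual.toDual t', h1, h2⟩)
    (fun β p q hqp hp => le_trans (Set.mem_ofPred_eq ▸ hp) (by
      have h : OrderDual.ofDual p ≤ OrderDual.ofDual q := hqp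
      rcases h.lt_or_eq with h | h
      · exact (level_lt h).le
      · rw [h]))
    (OrderDual.toDual t)
  -- The level of `q` is only known to bound every `β < a`; one proper extension reaches `a` itself.
  obtain ⟨t', ht'⟩ := hgt (OrderDual.ofDual q)
  refine ⟨t', le_trans (show t ≤ OrderDual.ofDual q from hq) ht'.le, ?_⟩
  by_contra hcon
  have h1 : level t' ≤ level (OrderDual.ofDual q) := by
    simpa using h (Ordinal.ToType.mk ⟨level t', not_le.1 hcon⟩)
  exact absurd (level_lt ht') (not_lt.2 h1)

end Level

section Branch

variable {T : Type u} [PartialOrder T]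

theorem eq_of_feq_code {P : Type u} [Preorder P] {s t : T} {p : P}
    (h : feq (PName.check (code s)) (PName.check (code t)) p) : s = t :=
  Ordinal.typein_injective _ (eq_of_feq_ordName h)

variable (T) in
/-- The name of the generic branch. -/
noncomputable def branchName : PName Tᵒᵈ :=
  PName.mk T (fun t => PName.check (code t)) OrderDual.toDual

theorem fmem_branchName {s : T} {r : Tᵒᵈ} (h : s ≤ OrderDual.ofDual r) :
    fmem (PName.check (code s)) (branchName T) r :=
  fmem_mk (a := fun t : T => PName.check (code t)) s h

theorem exists_of_fmem_branchName {x : PName Tᵒᵈ} {p : Tᵒᵈ} (h : fmem x (branchName T) p) :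
    ∃ r ≤ p, ∃ s ≤ OrderDual.ofDual r, feq x (PName.check (code s)) r := exists_of_fmem_mk h

theorem fmem_codeSet {P : Type u} [Preorder P] (s : T) (p : P) :
    fmem (PName.check (code s)) (PName.check (codeSet T)) p := fmem_check_func (codeSet T) s p

theorem exists_of_fmem_codeSet {P : Type u} [Preorder P] {x : PName P} {p : P}
    (h : fmem x (PName.check (codeSet T)) p) : ∃ r ≤ p, ∃ s : T, feq x (PName.check (code s)) r :=
  exists_of_fmem_check h

theorem ftreeLT_of_lt {P : Type u} [Preorder P] {s t : T} (h : s < t) {x y : PName P} {p : P}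
    (hx : feq x (PName.check (code s)) p) (hy : feq y (PName.check (code t)) p) :
    ftreeLT T x y p := fun q hq => ⟨q, le_rfl, ⟨(s, t), h⟩, feq_mono hx hq, feq_mono hy hq⟩

theorem lt_of_ftreeLT {P : Type u} [Preorder P] {s t : T} {x y : PName P} {p : P}
    (hx : feq x (PName.check (code s)) p) (hy : feq y (PName.check (code t)) p)
    (h : ftreeLT T x y p) : s < t := by
  obtain ⟨r, hr, ⟨⟨s', t'⟩, hlt⟩, h1, h2⟩ := h p le_rfl
  rw [eq_of_feq_code (feq_trans (feq_symm (feq_mono hx hr)) h1),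
    eq_of_feq_code (feq_trans (feq_symm (feq_mono hy hr)) h2)]
  exact hlt

theorem fcomparable_of_le_or {P : Type u} [Preorder P] {s t : T} (h : s ≤ t ∨ t ≤ s)
    {x y : PName P} {p : P}
    (hx : feq x (PName.check (code s)) p) (hy : feq y (PName.check (code t)) p) :
    fcomparable T x y p := by
  intro q hq
  have hx := feq_mono hx hq
  have hy := feq_mono hy hq
  by_cases heq : s = t
  · subst heq
    exact ⟨q, le_rfl, Or.inl (feq_trans hx (feq_symm hy))⟩
  · refine ⟨q, le_rfl, Or.inr fun q' hq' => ⟨q', le_rfl, ?_⟩⟩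
    have hx := feq_mono hx hq'
    have hy := feq_mono hy hq'
    rcases h with h | h
    · exact Or.inl (ftreeLT_of_lt (lt_of_le_of_ne h heq) hx hy)
    · exact Or.inr (ftreeLT_of_lt (lt_of_le_of_ne h (Ne.symm heq)) hy hx)

theorem le_or_of_fcomparable {P : Type u} [Preorder P] {s t : T} {x y : PName P} {p : P}
    (hx : feq x (PName.check (code s)) p) (hy : feq y (PName.check (code t)) p)
    (h : fcomparable T x y p) : s ≤ t ∨ t ≤ s := by
  obtain ⟨r, hr, h | h⟩ := h p le_rfl
  · exact Or.inl (eq_of_feq_code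
      (feq_trans (feq_trans (feq_symm (feq_mono hx hr)) h) (feq_mono hy hr))).le
  · obtain ⟨r', hr', h⟩ := h r le_rfl
    have hx := feq_mono hx (hr'.trans hr)
    have hy := feq_mono hy (hr'.trans hr)
    exact h.imp (fun h => (lt_of_ftreeLT hx hy h).le) fun h => (lt_of_ftreeLT hy hx h).le

/-- For maximality: an element comparable with the generic branch is comparable with the current
condition, hence either below it or itself a stronger condition. -/
theorem fbranch_branchName (hlin : ∀ a b c : T, a ≤ c → b ≤ c → a ≤ b ∨ b ≤ a) (p : Tᵒᵈ) :
    fbranch T (branchName T) p := by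
  refine ⟨fun x q _ hx => ?_, fun x q _ hx => ?_, fun x q _ hx => ?_⟩
  · obtain ⟨r, hr, s, -, he⟩ := exists_of_fmem_branchName hx
    exact ⟨r, hr, fmem_congr_left (feq_symm he) (fmem_codeSet s r)⟩
  · obtain ⟨r, hr, s, hs, he⟩ := exists_of_fmem_branchName hx
    refine ⟨r, hr, fun y q' hq' hy => ?_⟩
    obtain ⟨r', hr', t, ht, he'⟩ := exists_of_fmem_branchName hy
    exact ⟨r', hr', fcomparable_of_le_or
      (hlin s t _
        (le_trans hs (show OrderDual.ofDual r ≤ OrderDual.ofDual r' from hr'.trans hq')) ht)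
      (feq_mono he (hr'.trans hq')) he'⟩
  · obtain ⟨r, hr, s, he⟩ := exists_of_fmem_codeSet hx
    refine ⟨r, hr, fun q' hq' hcomp => ?_⟩
    obtain ⟨r₁, hr₁, h₁⟩ := hcomp (PName.check (code (OrderDual.ofDual q'))) q' le_rfl
      (fmem_branchName le_rfl)
    have hst : s ≤ OrderDual.ofDual q' ∨ OrderDual.ofDual q' ≤ s :=
      le_or_of_fcomparable (feq_mono he (hr₁.trans hq')) (feq_refl _ _) h₁
    rcases hst with h | h
    · exact ⟨q', le_rfl, fmem_congr_left (feq_symm (feq_mono he hq')) (fmem_branchName h)⟩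
    · have h' : OrderDual.toDual s ≤ q' := h
      exact ⟨OrderDual.toDual s, h', fmem_congr_left (feq_symm (feq_mono he (h'.trans hq')))
        (fmem_branchName le_rfl)⟩

variable [WellFoundedLT T]

variable (T) in
/-- The name of the enumeration of the generic branch. -/
noncomputable def enumName : PName Tᵒᵈ :=
  PName.mk T (fun t => PName.opair (ordName Tᵒᵈ (level t)) (PName.check (code t))) OrderDual.toDual

theorem fmem_enumName {s : T} {r : Tᵒᵈ} (h : s ≤ OrderDual.ofDual r) :
    fmem (PName.opair (ordName Tᵒᵈ (level s)) (PName.check (code s))) (enumName T) r :=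
  fmem_mk (a := fun t : T => PName.opair (ordName Tᵒᵈ (level t)) (PName.check (code t))) s h

theorem exists_of_fmem_enumName {x : PName Tᵒᵈ} {p : Tᵒᵈ} (h : fmem x (enumName T) p) :
    ∃ r ≤ p, ∃ s ≤ OrderDual.ofDual r,
      feq x (PName.opair (ordName Tᵒᵈ (level s)) (PName.check (code s))) r := exists_of_fmem_mk h

theorem exists_of_fmem_opair_enumName {x y : PName Tᵒᵈ} {p : Tᵒᵈ}
    (h : fmem (PName.opair x y) (enumName T) p) :
    ∃ r ≤ p, ∃ s ≤ OrderDual.ofDual r,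
      feq x (ordName Tᵒᵈ (level s)) r ∧ feq y (PName.check (code s)) r := by
  obtain ⟨r, hr, s, hs, he⟩ := exists_of_fmem_enumName h
  exact ⟨r, hr, s, hs, feq_fst_of_feq_opair he, feq_snd_of_feq_opair he⟩

theorem eq_of_level_eq (hlin : ∀ a b c : T, a ≤ c → b ≤ c → a ≤ b ∨ b ≤ a) {s t c : T}
    (hs : s ≤ c) (ht : t ≤ c) (h : level s = level t) : s = t := by
  rcases hlin s t c hs ht with h' | h'
  · exact eq_of_le_of_not_lt h' fun hlt => (level_lt hlt).ne h
  · exact (eq_of_le_of_not_lt h' fun hlt => (level_lt hlt).ne h.symm).symm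

/-- Elements of the branch below a common condition are comparable, so their levels determine them;
density of high levels makes the enumeration total. -/
theorem fbij_enumName {κ : Cardinal.{u}} (hlin : ∀ a b c : T, a ≤ c → b ≤ c → a ≤ b ∨ b ≤ a)
    (hlevel : ∀ t : T, level t < κ.ord)
    (hdense : ∀ a < κ.ord, ∀ t : T, ∃ t' ≥ t, a ≤ level t') (p : Tᵒᵈ) :
    fbij (enumName T) (ordName Tᵒᵈ κ.ord) (branchName T) p := by
  refine ⟨fun z q _ hz => ?_, fun a q _ ha => ?_, fun b q _ hb => ?_⟩
  · obtain ⟨r, hr, s, hs, he⟩ := exists_of_fmem_enumName hz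
    refine ⟨r, hr, fun r' hr' => ⟨r', le_rfl, _, fmem_ordName (hlevel s) r', fun r'' hr'' =>
      ⟨r'', le_rfl, _, fmem_mono (fmem_branchName hs) (hr''.trans hr'),
        feq_mono he (hr''.trans hr')⟩⟩⟩
  · obtain ⟨r, hr, α, hα, he⟩ := exists_of_fmem_ordName ha
    obtain ⟨t, hrt, ht⟩ := hdense α hα (OrderDual.ofDual r)
    obtain ⟨s, hst, rfl⟩ := exists_level_eq ht
    have htr : OrderDual.toDual t ≤ r := hrt
    refine ⟨OrderDual.toDual t, htr.trans hr, fun r' hr' => ⟨r', le_rfl, PName.check (code s), ?_⟩⟩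
    have hsr' : s ≤ OrderDual.ofDual r' := le_trans hst hr'
    have he := feq_mono he (hr'.trans htr)
    refine ⟨fmem_branchName hsr', fmem_congr_left (feq_opair (feq_symm he) (feq_refl _ _))
      (fmem_enumName hsr'), fun b' q' hq' _ => ⟨q', le_rfl, fun q'' hq'' hb' => ?_⟩⟩
    obtain ⟨w, hw, v, hv, h1, h2⟩ := exists_of_fmem_opair_enumName hb'
    have hwr' := hw.trans (hq''.trans hq')
    have hlev := eq_of_feq_ordName (feq_trans (feq_symm (feq_mono he hwr')) h1)
    rw [eq_of_level_eq hlin (le_trans hsr' hwr') hv hlev]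
    exact ⟨w, hw, h2⟩
  · obtain ⟨r, hr, s, hs, he⟩ := exists_of_fmem_branchName hb
    refine ⟨r, hr, fun r' hr' =>
      ⟨r', le_rfl, ordName Tᵒᵈ (level s), fmem_ordName (hlevel s) r', ?_⟩⟩
    have he := feq_mono he hr'
    refine ⟨fmem_congr_left (feq_opair (feq_refl _ _) (feq_symm he))
      (fmem_mono (fmem_enumName hs) hr'), fun a' q' hq' _ => ⟨q', le_rfl, fun q'' hq'' ha' => ?_⟩⟩
    obtain ⟨w, hw, v, hv, h1, h2⟩ := exists_of_fmem_opair_enumName ha'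
    have := eq_of_feq_code (feq_trans (feq_symm (feq_mono he (hw.trans (hq''.trans hq')))) h2)
    subst this
    exact ⟨w, hw, h1⟩

theorem addsBranch_of_dense_level {κ : Cardinal.{u}}
    (hlin : ∀ a b c : T, a ≤ c → b ≤ c → a ≤ b ∨ b ≤ a) (hlevel : ∀ t : T, level t < κ.ord)
    (hdense : ∀ a < κ.ord, ∀ t : T, ∃ t' ≥ t, a ≤ level t') : AddsBranch Tᵒᵈ T κ := by
  refine fun p q _ => ⟨q, le_rfl, branchName T, fbranch_branchName hlin q, fun q' _ =>
    ⟨q', le_rfl, enumName T, fbij_enumName hlin hlevel hdense q', ?_⟩⟩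
  refine fun a q _ _ => ⟨q, le_rfl, fun b q _ _ => ⟨q, le_rfl, fun q₀ _ hab => ⟨q₀, le_rfl, ?_⟩⟩⟩
  refine fun x q₁ hq₁ _ => ⟨q₁, le_rfl, fun y q₂ hq₂ _ => ⟨q₂, le_rfl, fun q₃ hq₃ hx =>
    ⟨q₃, le_rfl, fun q₄ hq₄ hy => ?_⟩⟩⟩
  obtain ⟨r, hr, s, hs, h1, h2⟩ := exists_of_fmem_opair_enumName (fmem_mono hx hq₄)
  obtain ⟨r', hr', t, ht, h3, h4⟩ := exists_of_fmem_opair_enumName (fmem_mono hy hr)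
  have hab' := fmem_mono hab (hr'.trans (hr.trans (hq₄.trans (hq₃.trans (hq₂.trans hq₁)))))
  have hlt : level s < level t := lt_of_fmem_ordName
    (fmem_congr_right h3 (fmem_congr_left (feq_mono h1 hr') hab'))
  refine ⟨r', hr'.trans hr, ftreeLT_of_lt ?_ (feq_mono h2 hr') h4⟩
  rcases hlin s t _ (le_trans hs hr') ht with h | h
  · exact lt_of_le_of_ne h fun h => hlt.ne (by rw [h])
  · rcases h.lt_or_eq with h | h
    · exact absurd (level_lt h) hlt.not_gt
    · exact absurd hlt (by rw [h]; exact lt_irrefl _)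

end Branch

/-- A tree with strictly increasing heights, without unbounded chains, in which every strategy
can be followed up to a stationary set of heights, is semi-proper. -/
theorem isSemiProperTree_of_hits {κ : Cardinal.{u}} [LargeRegular κ.ord.ToType] {T : Type u}
    [PartialOrder T] [Nonempty T] {ht : T → κ.ord.ToType} (hmono : StrictMono ht)
    (hlin : ∀ a b c : T, a ≤ c → b ≤ c → a ≤ b ∨ b ≤ a) (hcard : #T ≤ 2 ^ κ)
    (hcof : ∀ t ξ, ∃ t' ≥ t, ξ < ht t')
    (hchain : ∀ B : Set T, IsChain (· ≤ ·) B → ∃ b, ∀ c ∈ B, ht c < b)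
    (hhit : ∀ (p : T) (ext : T → T), (∀ c, c ≤ ext c) → ∀ S, IsStationary S →
      ∃ i ∈ S, ∃ q ≥ p, ∀ η < i, ∃ c ≥ p, ext c ≤ q ∧ η < ht c ∧ ht (ext c) < i) :
    IsSemiProperTree (Order.succ (2 ^ κ)) κ T := by
  have hwf : WellFoundedLT T := hmono.wellFoundedLT
  have hhits : Hits (P := Tᵒᵈ) fun t => ht (OrderDual.ofDual t) := fun p ext hext S hS =>
    hhit p ext hext S hS
  have hdist : Distributive Tᵒᵈ κ := by
    have := distributive_of_hits (P := Tᵒᵈ) (ht := fun t => ht (OrderDual.ofDual t))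
      (fun a b q ha hb hab => by
        rcases hlin (OrderDual.ofDual a) (OrderDual.ofDual b) (OrderDual.ofDual q) ha hb with h | h
        · exact h
        · rcases h.lt_or_eq with h | h
          · exact absurd (hmono h) (not_lt.2 hab)
          · exact (OrderDual.ofDual_inj.1 h).le) hhits
    rwa [mk_ord_toType] at this
  have hwo : ∀ B : Set T, IsChain (· ≤ ·) B → IsWellOrder B (· < ·) := fun B hB =>
    { trichotomous := fun a b h1 h2 => by
        by_contra hne
        rcases hB.total a.2 b.2 with h | h
        · exact h1 (lt_of_le_of_ne h hne)
        · exact h2 (lt_of_le_of_ne h (Ne.symm hne))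
      wf := wellFounded_lt }
  refine
    { nonempty := inferInstance
      wellOrdered := fun x => hwo _ fun a ha b hb _ => hlin a b x (le_of_lt ha) (le_of_lt hb)
      branch_lt := fun B hB => ⟨hwo B hB.1, ?_⟩
      succ_lt := fun x => ?_
      addsBranch := ?_
      preservesStationary := ?_
      addsNoSmallSets := ?_ }
  · obtain ⟨b, hb⟩ := hchain B hB.1
    have := hwo B hB.1
    rw [lt_ord, Ordinal.card_type]
    -- Heights embed the branch into a proper initial segment of `κ`, which has fewer than `κ`
    -- elements.
    have hinj : Function.Injective fun c : B => (⟨ht c, hb c c.2⟩ : Set.Iio b) := by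
      intro c d h
      have h : ht c = ht d := congrArg Subtype.val h
      by_contra hne
      have hne' : (c : T) ≠ d := fun h => hne (Subtype.ext h)
      rcases hB.1.total c.2 d.2 with h' | h'
      · exact (hmono (lt_of_le_of_ne h' hne')).ne h
      · exact (hmono (lt_of_le_of_ne h' hne'.symm)).ne h.symm
    refine (mk_le_of_injective hinj).trans_lt ?_
    have := LargeRegular.mk_Iio_lt b
    rwa [mk_ord_toType] at this
  -- The size of the whole tree already bounds the number of immediate successors.
  · exact lt_succ_iff.2 ((mk_subtype_le _).trans hcard)
  · refine addsBranch_of_dense_level hlin (level_lt_ord hmono) fun a ha t =>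
      exists_le_level hdist (fun t => ?_) ha t
    obtain ⟨t', h, hlt⟩ := hcof t (ht t)
    exact ⟨t', lt_of_le_of_ne h fun h => hlt.ne (by rw [h])⟩
  · exact preservesStationary_of_hits _ (fun p ξ => hcof (OrderDual.ofDual p) ξ) hhits
  · exact addsNoSmallSets_of_distributive hdist

end SetForcing

/-! ### Coherent systems of clubs without a thread, and guessing by gap ends -/

namespace LargeRegular

section Coherent

variable {K : Type u} [LinearOrder K] [WellFoundedLT K]

/-- `δ` is a limit. -/
abbrev Lim (δ : K) : Prop := Acc Set.univ δ

theorem Acc.lim {X : Set K} {δ : K} (h : Acc X δ) : Lim δ := h.mono (Set.subset_univ _)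

theorem Acc.inter_Iio {X : Set K} {δ i : K} (h : Acc X δ) (hi : δ ≤ i) :
    Acc (X ∩ Set.Iio i) δ :=
  ⟨h.1, fun η hη => by
    obtain ⟨x, hx, h1, h2⟩ := h.2 η hη
    exact ⟨x, ⟨hx, h2.trans_le hi⟩, h1, h2⟩⟩

theorem exists_least {s : Set K} (h : s.Nonempty) : ∃ m ∈ s, ∀ z ∈ s, m ≤ z :=
  ⟨wellFounded_lt.min s h, wellFounded_lt.min_mem s h, fun _ hz =>
    not_lt.1 (wellFounded_lt.not_lt_min s hz)⟩

/-- A point which is not a limit of `X` and lies above some point of the closed set `X`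
has a largest element of `X` below it. -/
theorem exists_max_lt {X : Set K} {δ x : K} (hδ : ¬ Acc X δ)
    (hx : x ∈ X) (hxδ : x < δ) (hcl : ∀ β < δ, Acc X β → β ∈ X) :
    ∃ y ∈ X, y < δ ∧ ∀ z ∈ X, z < δ → z ≤ y := by
  have hne : {b | b < δ ∧ ∀ z ∈ X, z < δ → z ≤ b}.Nonempty := by
    by_contra hcon
    refine hδ ⟨⟨x, hxδ⟩, fun η hη => ?_⟩
    by_contra hcon'
    push Not at hcon'
    refine hcon ⟨η, hη, fun z hz hzδ => ?_⟩
    by_contra h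
    exact absurd (hcon' z hz (not_le.1 h)) (not_le.2 hzδ)
  obtain ⟨y, hy, hmin⟩ := exists_least hne
  by_cases hyX : y ∈ X
  · exact ⟨y, hyX, hy⟩
  · refine absurd (hcl y hy.1 ⟨⟨x, lt_of_le_of_ne (hy.2 x hx hxδ) ?_⟩, fun η hη => ?_⟩) hyX
    · rintro rfl; exact hyX hx
    · by_contra hcon
      push Not at hcon
      refine absurd (hmin η ⟨hη.trans hy.1, fun z hz hzδ => ?_⟩) (not_le.2 hη)
      by_contra h
      have h1 := hcon z hz (not_le.1 h)
      have h2 := hy.2 z hz hzδ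
      exact hyX (le_antisymm h2 h1 ▸ hz)

/-- The clause of a coherent system of clubs at the limit `i`. -/
structure LadderAt (C : K → Set K) (i : K) : Prop where
  subset : C i ⊆ Set.Iio i
  acc : Acc (C i) i
  closed : ∀ δ < i, Acc (C i) δ → δ ∈ C i
  nacc : ∀ β ∈ C i, Lim β → Acc (C i) β
  coherent : ∀ j < i, Acc (C i) j → C j = C i ∩ Set.Iio j

/-- A coherent system of clubs, whose elements that are not limit points are successors,
without a thread. -/
structure Unthreaded (C : K → Set K) : Prop where
  ladder : ∀ i, Lim i → LadderAt C i
  not_thread : ∀ T : Set K, (∀ η, ∃ x ∈ T, η < x) → ¬ ∀ j, Acc T j → C j = T ∩ Set.Iio j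

variable [hK : LargeRegular K]

/-- Fodor makes the bound constant, say `η₀`. Each limit `j > η₀` of `E` is then a limit point of `C
i` for stationarily many `i`, so by coherence the sets `C j` for such `j` extend one another and
their union is a thread. -/
theorem Unthreaded.false_of_tails {C : K → Set K} (hC : Unthreaded C) {E R : Set K}
    (hE : IsClub E) (hR : IsStationary R) (η : K → K)
    (h : ∀ i ∈ R, Lim i ∧ η i < i ∧ ∀ x ∈ E, η i < x → x < i → x ∈ C i) : False := by
  obtain ⟨η₀, hR'⟩ := fodor hR (f := η) fun i hi => (h i hi).2.1
  let J : Set K := {j | Acc E j ∧ η₀ < j}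
  have hJ : ∀ j ∈ J, ∀ i ∈ {i ∈ R | η i = η₀}, j < i → C j = C i ∩ Set.Iio j := by
    rintro j ⟨hj, hj0⟩ i ⟨hi, rfl⟩ hji
    refine ((hC.ladder i (h i hi).1).coherent j hji ?_)
    exact hj.of_tail hj0 fun x hx h1 h2 => (h i hi).2.2 x hx h1 (h2.trans hji)
  have hJJ : ∀ j ∈ J, ∀ j' ∈ J, j < j' → C j = C j' ∩ Set.Iio j := by
    intro j hj j' hj' hlt
    obtain ⟨i, hi, hji⟩ := IsStationary_unbounded hR' j'
    rw [hJ j hj i hi (hlt.trans hji), hJ j' hj' i hi hji, Set.inter_assoc,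
      Set.Iio_inter_Iio, min_eq_right hlt.le]
  have hJub : ∀ ζ, ∃ j ∈ J, ζ < j := by
    intro ζ
    obtain ⟨j, hj, hlt⟩ := (isClub_iff_acc.1 (isClub_acc hE)).2 (max ζ η₀)
    exact ⟨j, ⟨hj, (le_max_right _ _).trans_lt hlt⟩, (le_max_left _ _).trans_lt hlt⟩
  have hT : ∀ j ∈ J, (⋃ k ∈ J, C k) ∩ Set.Iio j = C j := by
    intro j hj
    ext x
    simp only [Set.mem_inter_iff, Set.mem_iUnion, Set.mem_Iio]
    constructor
    · rintro ⟨⟨k, hk, hx⟩, hxj⟩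
      rcases lt_trichotomy j k with hjk | rfl | hkj
      · rw [hJJ j hj k hk hjk]; exact ⟨hx, hxj⟩
      · exact hx
      · rw [hJJ k hk j hj hkj] at hx; exact hx.1
    · intro hx
      exact ⟨⟨j, hj, hx⟩, (hC.ladder j hj.1.lim).subset hx⟩
  refine hC.not_thread (⋃ k ∈ J, C k) (fun ζ => ?_) fun j hj => ?_
  · obtain ⟨j, hj, hlt⟩ := hJub ζ
    obtain ⟨x, hx, h1, -⟩ := (hC.ladder j hj.1.lim).acc.2 ζ hlt
    exact ⟨x, Set.mem_biUnion hj hx, h1⟩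
  · obtain ⟨k, hk, hjk⟩ := hJub j
    have h1 : Acc (C k) j := by rw [← hT k hk]; exact hj.inter_Iio hjk.le
    rw [(hC.ladder k hk.1.lim).coherent j hjk h1, ← hT k hk, Set.inter_assoc,
      Set.Iio_inter_Iio, min_eq_right hjk.le]

/-- The points of `E₀` which are the last ones of `E₀` in an interval of `δ` disjoint
from `C δ`. -/
def gapEnds (C : K → Set K) (E₀ : Set K) (δ : K) : Set K :=
  {x | x ∈ E₀ ∧ x < δ ∧ ∃ β ∈ C δ, x < β ∧ (∀ z ∈ C δ, x ≤ z → β ≤ z) ∧ ∀ z ∈ E₀, x < z → β ≤ z}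

/-- An infinite set in a well-order contains an increasing sequence, along which `y` would descend
forever. -/
theorem not_infinite_of_strictAnti {W : Type v} [LinearOrder W] [WellFoundedLT W] {X : Set W}
    {y : W → K} (hy : ∀ a ∈ X, ∀ b ∈ X, a < b → y b < y a) : ¬ X.Infinite := by
  intro hX
  have := hX.to_subtype
  let f := Infinite.natEmbedding X
  obtain ⟨g, hg | hg⟩ := exists_increasing_or_nonincreasing_subseq (· < ·) f
  · refine not_strictAnti_of_wellFoundedLT (fun n => y (f (g n))) fun m n hmn => ?_
    exact hy _ (f _).2 _ (f _).2 (hg m n hmn)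
  · refine not_strictAnti_of_wellFoundedLT (fun n => f (g n)) fun m n hmn => ?_
    refine lt_of_le_of_ne (not_lt.1 (hg m n hmn)) fun h => ?_
    exact hmn.ne' (g.injective (f.injective h))

/-- Otherwise every club `E₀` has a counterexample `N E₀`. Intersecting with counterexamples `ω₁`
times gives decreasing clubs `E ξ` and a common refinement `F`. At a limit `δ` of `F` of cofinality
`ω`, a tail of `F` below `δ` must lie in `C δ`: for a point `x` outside it, the last points of the
`E ξ` in the gap around `x` would descend at infinitely many indices. This contradicts
`false_of_tails`. -/
theorem Unthreaded.exists_gapEnds {C : K → Set K} (hC : Unthreaded C) :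
    ∃ E₀ : Set K, IsClub E₀ ∧ ∀ E : Set K, IsClub E →
      ∃ δ, Acc E δ ∧ Acc (gapEnds C E₀ δ ∩ E) δ := by
  by_contra hcon
  push Not at hcon
  choose! N hN hNacc using hcon
  let Ω := (ℵ₁ : Cardinal.{u}).ord.ToType
  have hΩ : #Ω = ℵ₁ := mk_ord_toType _
  have hsmall : ∀ X : Set Ω, #X < #K := fun X =>
    ((mk_set_le X).trans hΩ.le).trans_lt hK.aleph_one_lt
  let next : Set K → Set K := fun E => N E ∩ E
  let E : Ω → Set K := WellFoundedLT.fix fun ξ f => ⋂ ζ : Set.Iio ξ, next (f ζ.1 ζ.2)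
  have hE : ∀ ξ, E ξ = ⋂ ζ : Set.Iio ξ, next (E ζ.1) := fun ξ => WellFoundedLT.fix_eq _ ξ
  have hclub : ∀ ξ, IsClub (E ξ) := by
    intro ξ
    induction ξ using WellFoundedLT.induction with
    | ind ξ ih =>
      rw [hE]
      exact isClub_iInter (hsmall _) fun ζ => isClub_inter (hN _ (ih _ ζ.2)) (ih _ ζ.2)
  have hlt : ∀ ζ ξ, ζ < ξ → E ξ ⊆ next (E ζ) := by
    intro ζ ξ h
    rw [hE ξ]
    exact Set.iInter_subset (fun ζ : Set.Iio ξ => next (E ζ.1)) ⟨ζ, h⟩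
  let F : Set K := ⋂ ξ, next (E ξ)
  have hF : IsClub F :=
    isClub_iInter (hΩ.trans_lt hK.aleph_one_lt) fun ξ =>
      isClub_inter (hN _ (hclub _)) (hclub _)
  have hω : Cardinal.lift.{u} #ℕ < Cardinal.lift.{0} #K := by
    simpa using aleph0_lt_mk (K := K)
  have key : ∀ δ ∈ {δ : K | ∃ s : ℕ → K, StrictMono s ∧ (∀ i, s i < δ) ∧ ∀ η < δ, ∃ i, η < s i} ∩
      {δ | Acc F δ}, Lim δ ∧ ∃ η < δ, ∀ x ∈ F, η < x → x < δ → x ∈ C δ := by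
    rintro δ ⟨⟨s, -, hs1, hs2⟩, hδ⟩
    refine ⟨hδ.lim, ?_⟩
    have hL := hC.ladder δ hδ.lim
    have hb : ∀ ξ, ∃ n, ∀ x ∈ gapEnds C (E ξ) δ, x ∈ N (E ξ) → x ≤ s n := by
      intro ξ
      have h1 := hNacc (E ξ) (hclub ξ) δ (hδ.mono fun x hx => (Set.mem_iInter.1 hx ξ).1)
      by_contra hcon
      push Not at hcon
      refine h1 ⟨hδ.1, fun η hη => ?_⟩
      obtain ⟨n, hn⟩ := hs2 η hη
      obtain ⟨x, hx, hxN, hlt⟩ := hcon n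
      exact ⟨x, ⟨hx, hxN⟩, hn.trans hlt, hx.2.1⟩
    choose g hg using hb
    -- There are `ℵ₁` indices and only countably many bounds `s n`, so one bound serves infinitely
    -- many indices.
    have hfib : ∃ n, (g ⁻¹' {n}).Infinite := by
      by_contra hcon
      simp only [not_exists, Set.not_infinite] at hcon
      have h1 : (⋃ n, g ⁻¹' {n}).Countable := Set.countable_iUnion fun n => (hcon n).countable
      have h2 : (⋃ n, g ⁻¹' {n}) = Set.univ := by ext; simp
      rw [h2, Set.countable_univ_iff, ← mk_le_aleph0_iff, hΩ] at h1
      exact absurd h1 (not_le.2 aleph0_lt_aleph_one)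
    obtain ⟨n, hn⟩ := hfib
    refine ⟨s n, hs1 n, fun x hxF hx1 hx2 => ?_⟩
    by_contra hxC
    have hne : {β | β ∈ C δ ∧ x < β}.Nonempty := by
      obtain ⟨β, hβ, h, -⟩ := hL.acc.2 x hx2
      exact ⟨β, hβ, h⟩
    obtain ⟨β, ⟨hβC, hxβ⟩, hmin⟩ := exists_least hne
    have hmin' : ∀ z ∈ C δ, x ≤ z → β ≤ z := fun z hz hxz =>
      hmin z ⟨hz, lt_of_le_of_ne hxz fun h => hxC (h ▸ hz)⟩
    have hnacc : ¬ Lim β := by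
      intro h
      obtain ⟨z, hz, h1, h2⟩ := (hL.nacc β hβC h).2 x hxβ
      exact absurd (hmin' z hz h1.le) (not_le.2 h2)
    have hy : ∀ ξ, ∃ y ∈ E ξ, y < β ∧ ∀ z ∈ E ξ, z < β → z ≤ y := fun ξ =>
      exists_max_lt (fun h => hnacc h.lim) ((Set.mem_iInter.1 hxF ξ).2) hxβ
        fun γ _ => (isClub_iff_acc.1 (hclub ξ)).1 γ
    choose y hyE hyβ hymax using hy
    -- If the last point were the same for `a < b`, it would be a gap end for `E a` lying in `N (E
    -- a)` above `s n`.
    refine not_infinite_of_strictAnti (X := g ⁻¹' {n}) (y := y) (fun a ha b hb hab => ?_) hn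
    have hsub := hlt a b hab (hyE b)
    refine lt_of_le_of_ne (hymax a _ hsub.2 (hyβ b)) fun h => ?_
    have hxy : x ≤ y a := hymax a x (Set.mem_iInter.1 hxF a).2 hxβ
    have : y a ∈ gapEnds C (E a) δ := by
      refine ⟨hyE a, (hyβ a).trans (hL.subset hβC), β, hβC, hyβ a,
        fun z hz h => ?_, fun z hz h => ?_⟩
      · exact hmin' z hz (hxy.trans h)
      · by_contra hzβ
        exact absurd (hymax a z hz (not_le.1 hzβ)) (not_le.2 h)
    have h3 := hg a _ this (h ▸ hsub.1)
    rw [show g a = n from ha] at h3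
    exact absurd (hx1.trans_le hxy) (not_lt.2 h3)
  choose! hl η hη using key
  exact hC.false_of_tails hF (isStationary_inter (isStationary_sup hω) (isClub_acc hF)) η
    fun i hi => ⟨hl i hi, hη i hi⟩

end Coherent

end LargeRegular

/-! ### The tree of closed sets with few gap ends -/

namespace LargeRegular

section GapTree

variable {K : Type u} [LinearOrder K] [WellFoundedLT K]

/-- `X` together with its limit points. -/
def cl (X : Set K) : Set K := X ∪ {δ | Acc X δ}

/-- Closed bounded sets which contain boundedly many of the points `gapEnds C E₀ δ`, for each
of their limit points `δ`. -/
@[ext] structure GapTree (C : K → Set K) (E₀ : Set K) where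
  carrier : Set K
  top : K
  isGreatest : IsGreatest carrier top
  closed : ∀ δ, Acc carrier δ → δ ∈ carrier
  bounded : ∀ δ, Acc carrier δ → ¬ Acc (carrier ∩ gapEnds C E₀ δ) δ

namespace GapTree

variable {C : K → Set K} {E₀ : Set K}

theorem carrier_injective : Function.Injective (carrier : GapTree C E₀ → Set K) := by
  intro c d h
  exact GapTree.ext h (c.isGreatest.unique (h ▸ d.isGreatest))

/-- End-extension. -/
instance : PartialOrder (GapTree C E₀) where
  le c d := c.carrier ⊆ d.carrier ∧ ∀ x ∈ d.carrier, ∀ y ∈ c.carrier, x ≤ y → x ∈ c.carrier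
  le_refl c := ⟨subset_rfl, fun _ hx _ _ _ => hx⟩
  le_trans a b c hab hbc := ⟨hab.1.trans hbc.1, fun x hx y hy hxy =>
    hab.2 x (hbc.2 x hx y (hab.1 hy) hxy) y hy hxy⟩
  le_antisymm a b hab hba := carrier_injective (hab.1.antisymm hba.1)

theorem le_top {c : GapTree C E₀} {x : K} (hx : x ∈ c.carrier) : x ≤ c.top := c.isGreatest.2 hx

theorem top_mem (c : GapTree C E₀) : c.top ∈ c.carrier := c.isGreatest.1

theorem top_strictMono : StrictMono (top : GapTree C E₀ → K) := by
  intro c d hcd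
  refine lt_of_le_of_ne (le_top (hcd.le.1 c.top_mem)) fun h => hcd.not_ge ?_
  have h1 : d.carrier ⊆ c.carrier := fun x hx =>
    hcd.le.2 x hx c.top c.top_mem (h ▸ le_top hx)
  exact ⟨h1, fun x hx y _ _ => hcd.le.1 hx⟩

theorem top_mono {c d : GapTree C E₀} (h : c ≤ d) : c.top ≤ d.top :=
  top_strictMono.monotone h

theorem le_total_of_le {a b c : GapTree C E₀} (ha : a ≤ c) (hb : b ≤ c) : a ≤ b ∨ b ≤ a := by
  rcases le_total a.top b.top with h | h
  · left
    refine ⟨fun x hx => hb.2 x (ha.1 hx) _ b.top_mem ((le_top hx).trans h), fun x hx y hy hxy => ?_⟩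
    exact ha.2 x (hb.1 hx) y hy hxy
  · right
    refine ⟨fun x hx => ha.2 x (hb.1 hx) _ a.top_mem ((le_top hx).trans h), fun x hx y hy hxy => ?_⟩
    exact hb.2 x (ha.1 hx) y hy hxy

/-- The set of all points of a family of conditions. -/
def points (S : Set (GapTree C E₀)) : Set K := ⋃ c ∈ S, c.carrier

theorem mem_points {S : Set (GapTree C E₀)} {x : K} : x ∈ points S ↔ ∃ c ∈ S, x ∈ c.carrier := by
  simp [points]

/-- Below its top, a member of a chain already contains everything that the chain and its closure
contribute. -/
theorem mem_of_le_of_mem_cl {S : Set (GapTree C E₀)} (hS : IsChain (· ≤ ·) S) {c : GapTree C E₀}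
    (hc : c ∈ S) {x y : K} (hx : x ∈ cl (points S)) (hy : y ∈ c.carrier) (hxy : x ≤ y) :
    x ∈ c.carrier := by
  have key : ∀ x ∈ points S, x ≤ y → x ∈ c.carrier := by
    intro x hx hxy
    obtain ⟨d, hd, hxd⟩ := mem_points.1 hx
    rcases hS.total hc hd with h | h
    · exact h.2 x hxd y hy hxy
    · exact h.1 hxd
  rcases hx with hx | hx
  · exact key x hx hxy
  · refine c.closed x ⟨hx.1, fun η hη => ?_⟩
    obtain ⟨z, hz, h1, h2⟩ := hx.2 η hη
    exact ⟨z, key z hz (h2.le.trans hxy), h1, h2⟩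

theorem acc_points_of_acc_cl {X : Set K} {γ δ : K} (hγ : ∀ x ∈ X, x ≤ γ)
    (h : Acc (cl X ∪ {γ}) δ) : Acc X δ := by
  refine ⟨h.1, fun η hη => ?_⟩
  obtain ⟨x, hx, h1, h2⟩ := h.2 η hη
  have hxX : x ∈ cl X := by
    rcases hx with hx | rfl
    · exact hx
    · obtain ⟨z, hz, h3, h4⟩ := h.2 x h2
      rcases hz with (hz | hz) | rfl
      · exact absurd (hγ z hz) (not_le.2 h3)
      · obtain ⟨w, hw, h5, h6⟩ := hz.2 x h3
        exact absurd (hγ w hw) (not_le.2 h5)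
      · exact absurd h3 (lt_irrefl _)
  rcases hxX with hx | hx
  · exact ⟨x, hx, h1, h2⟩
  · obtain ⟨w, hw, h5, h6⟩ := hx.2 η h1
    exact ⟨w, hw, h5, h6.trans h2⟩

/-- Close off a chain and add a new top. -/
theorem exists_closure {S : Set (GapTree C E₀)} (hS : IsChain (· ≤ ·) S) {γ : K}
    (hγ : ∀ x ∈ points S, x < γ)
    (hb : ∀ δ, Acc (points S) δ → δ ∉ points S → ¬ Acc (points S ∩ gapEnds C E₀ δ) δ) :
    ∃ d : GapTree C E₀, d.carrier = cl (points S) ∪ {γ} ∧ d.top = γ ∧ ∀ c ∈ S, c ≤ d := by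
  have hγ' : ∀ x ∈ cl (points S), x ≤ γ := by
    rintro x (hx | hx)
    · exact (hγ x hx).le
    · by_contra h
      obtain ⟨w, hw, h5, -⟩ := hx.2 γ (not_le.1 h)
      exact absurd (hγ w hw) (not_lt.2 h5.le)
  have hsub : ∀ c ∈ S, c.carrier ⊆ points S := fun c hc x hx => mem_points.2 ⟨c, hc, hx⟩
  refine ⟨⟨cl (points S) ∪ {γ}, γ, ⟨Or.inr rfl, ?_⟩, ?_, ?_⟩, rfl, rfl, ?_⟩
  · rintro x (hx | rfl)
    · exact hγ' x hx
    · exact le_rfl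
  · intro δ hδ
    exact Or.inl (Or.inr (acc_points_of_acc_cl (fun x hx => (hγ x hx).le) hδ))
  · intro δ hδ hacc
    have hδ' := acc_points_of_acc_cl (fun x hx => (hγ x hx).le) hδ
    have hδγ : δ ≤ γ := hγ' δ (Or.inr hδ')
    have hcl : ∀ x, x ∈ cl (points S) ∪ {γ} → x < δ → x ∈ cl (points S) := by
      rintro x (hx | rfl) h
      · exact hx
      · exact absurd h (not_lt.2 hδγ)
    -- If a point of the chain reaches `δ`, the condition containing that point settles the matter.
    -- Otherwise `δ` is the supremum of the points, every element of the closure below `δ` is a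
    -- point, and `hb` applies.
    by_cases hδS : ∃ y ∈ points S, δ ≤ y
    · obtain ⟨y, hy, hδy⟩ := hδS
      obtain ⟨c, hc, hyc⟩ := mem_points.1 hy
      have h1 : ∀ x ∈ cl (points S), x < δ → x ∈ c.carrier := fun x hx hxδ =>
        mem_of_le_of_mem_cl hS hc hx hyc (hxδ.le.trans hδy)
      refine c.bounded δ ⟨hδ.1, fun η hη => ?_⟩ ⟨hδ.1, fun η hη => ?_⟩
      · obtain ⟨x, hx, h2, h3⟩ := hδ.2 η hη
        exact ⟨x, h1 x (hcl x hx h3) h3, h2, h3⟩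
      · obtain ⟨x, hx, h2, h3⟩ := hacc.2 η hη
        exact ⟨x, ⟨h1 x (hcl x hx.1 h3) h3, hx.2⟩, h2, h3⟩
    · push Not at hδS
      refine hb δ hδ' (fun h => absurd (hδS δ h) (lt_irrefl _)) ⟨hδ.1, fun η hη => ?_⟩
      obtain ⟨x, hx, h2, h3⟩ := hacc.2 η hη
      have hx' := hcl x hx.1 h3
      obtain ⟨y, hy, hxy, -⟩ := hδ'.2 x h3
      obtain ⟨c, hc, hyc⟩ := mem_points.1 hy
      exact ⟨x, ⟨hsub c hc (mem_of_le_of_mem_cl hS hc hx' hyc hxy.le), hx.2⟩, h2, h3⟩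
  · intro c hc
    refine ⟨fun x hx => Or.inl (Or.inl (hsub c hc hx)), fun x hx y hy hxy => ?_⟩
    rcases hx with hx | rfl
    · exact mem_of_le_of_mem_cl hS hc hx hy hxy
    · exact absurd (hγ y (hsub c hc hy)) (not_lt.2 hxy)

theorem points_singleton (c : GapTree C E₀) : points {c} = c.carrier := by simp [points]

theorem exists_lt_top [NoMaxOrder K] (c : GapTree C E₀) (ξ : K) : ∃ d ≥ c, ξ < d.top := by
  obtain ⟨ζ, hζ⟩ := exists_gt (max ξ c.top)
  obtain ⟨d, -, h1, h2⟩ := exists_closure (S := {c}) (IsChain.singleton) (γ := ζ)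
    (fun x hx => by
      rw [points_singleton] at hx
      exact (le_top hx).trans_lt ((le_max_right _ _).trans_lt hζ))
    (fun δ hδ h => by
      rw [points_singleton] at hδ h
      exact absurd (c.closed δ hδ) h)
  exact ⟨d, h2 c rfl, h1 ▸ (le_max_left _ _).trans_lt hζ⟩

theorem mk_le : #(GapTree C E₀) ≤ 2 ^ #K :=
  (mk_le_of_injective carrier_injective).trans (mk_set).le

theorem nonempty [Nonempty K] : Nonempty (GapTree C E₀) := by
  obtain ⟨m, -, hm⟩ := exists_least (Set.univ_nonempty (α := K))
  have hacc : ∀ δ, ¬ Acc {m} δ := by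
    rintro δ ⟨⟨η, hη⟩, h⟩
    obtain ⟨x, rfl, -, h2⟩ := h η hη
    obtain ⟨y, rfl, h3, -⟩ := h x h2
    exact lt_irrefl _ h3
  exact ⟨⟨{m}, m, isGreatest_singleton,
    fun δ h => absurd h (hacc δ), fun δ h => absurd h (hacc δ)⟩⟩

/-- The union of an unbounded chain is a club `E`. At a `δ` guessed for `E`, a single condition
reaching `δ` contains cofinally many gap ends, which it must not. -/
theorem chain_bounded [LargeRegular K]
    (hE₀ : ∀ E : Set K, IsClub E → ∃ δ, Acc E δ ∧ Acc (gapEnds C E₀ δ ∩ E) δ)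
    {B : Set (GapTree C E₀)} (hB : IsChain (· ≤ ·) B) : ∃ b, ∀ c ∈ B, c.top < b := by
  by_contra hcon
  push Not at hcon
  have hacc : ∀ δ X, Acc (points B ∩ X) δ → ∃ c ∈ B, δ ≤ c.top ∧ Acc (c.carrier ∩ X) δ := by
    intro δ X hδ
    obtain ⟨c, hc, hδc⟩ := hcon δ
    refine ⟨c, hc, hδc, hδ.1, fun η hη => ?_⟩
    obtain ⟨x, hx, h1, h2⟩ := hδ.2 η hη
    exact ⟨x, ⟨mem_of_le_of_mem_cl hB hc (Or.inl hx.1) c.top_mem (h2.le.trans hδc), hx.2⟩, h1, h2⟩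
  have hclub : IsClub (points B) := by
    rw [isClub_iff_acc]
    refine ⟨fun δ hδ => ?_, fun η => ?_⟩
    · obtain ⟨c, hc, -, h⟩ := hacc δ Set.univ (by simpa using hδ)
      exact mem_points.2 ⟨c, hc, c.closed δ (by simpa using h)⟩
    · obtain ⟨ζ, hζ⟩ := exists_gt η
      obtain ⟨c, hc, h⟩ := hcon ζ
      exact ⟨c.top, mem_points.2 ⟨c, hc, c.top_mem⟩, hζ.trans_le h⟩
  obtain ⟨δ, h1, h2⟩ := hE₀ _ hclub
  rw [Set.inter_comm] at h2
  obtain ⟨c, hc, -, h⟩ := hacc δ _ h2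
  exact c.bounded δ (h.mono Set.inter_subset_left) h

end GapTree

end GapTree

end LargeRegular

/-! ### Runs of a strategy along a ladder, and hits in the gap tree -/

namespace LargeRegular

variable {K : Type u} [LinearOrder K] [WellFoundedLT K]

theorem isStationary_or [LargeRegular K] {S : Set K} (hS : IsStationary S) (P : K → Prop) :
    IsStationary {i ∈ S | P i} ∨ IsStationary {i ∈ S | ¬ P i} := by
  by_contra hcon
  push Not at hcon
  simp_rw [not_isStationary_iff] at hcon
  obtain ⟨⟨E, hE, h1⟩, F, hF, h2⟩ := hcon
  obtain ⟨i, hi, hiE, hiF⟩ := hS (isClub_inter hE hF)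
  by_cases hP : P i
  · exact Set.disjoint_left.1 h1 ⟨hi, hP⟩ hiE
  · exact Set.disjoint_left.1 h2 ⟨hi, hP⟩ hiF

/-- Coherent ladders of stationarily many limits agree below a given bound. -/
theorem exists_stationary_inter_Iio_const [LargeRegular K] {C : K → Set K}
    (hC : ∀ i, Lim i → LadderAt C i) (γ : K) {B : Set K} (hB : IsStationary B)
    (hlim : ∀ i ∈ B, Lim i) :
    ∃ B' ⊆ B, IsStationary B' ∧ ∃ X, ∀ i ∈ B', C i ∩ Set.Iio γ = X := by
  induction γ using WellFoundedLT.induction generalizing B with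
  | ind γ ih =>
  wlog hγ : ∀ i ∈ B, γ < i generalizing B
  · obtain ⟨B', h1, h2⟩ := this (isStationary_Ioi_inter hB γ) (fun i hi => hlim i hi.1)
      (fun i hi => hi.2)
    exact ⟨B', h1.trans Set.inter_subset_left, h2⟩
  -- If `γ` is a limit point of `C i`, coherence gives `C γ`. If not, and `C i` meets `γ`, it has a
  -- largest element below `γ`; Fodor fixes that element, and the induction continues below it.
  rcases isStationary_or hB (fun i => Acc (C i) γ) with h | h
  · refine ⟨_, Set.sep_subset _ _, h, C γ, fun i hi => ?_⟩
    exact ((hC i (hlim i hi.1)).coherent γ (hγ i hi.1) hi.2).symm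
  rcases isStationary_or h (fun i => C i ∩ Set.Iio γ = ∅) with h' | h'
  · exact ⟨_, fun i hi => hi.1.1, h', ∅, fun i hi => hi.2⟩
  have hmax : ∀ i ∈ {i ∈ {i ∈ B | ¬ Acc (C i) γ} | ¬ C i ∩ Set.Iio γ = ∅},
      ∃ y ∈ C i, y < γ ∧ ∀ z ∈ C i, z < γ → z ≤ y := by
    rintro i ⟨⟨hi, hacc⟩, hne⟩
    obtain ⟨x, hx, hxγ⟩ := Set.nonempty_iff_ne_empty.2 hne
    exact exists_max_lt hacc hx hxγ fun β hβ =>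
      (hC i (hlim i hi)).closed β (hβ.trans (hγ i hi))
  choose! s hsC hsγ hsmax using hmax
  obtain ⟨s₀, hs₀⟩ := fodor h' (f := s) fun i hi => (hsγ i hi).trans (hγ i hi.1.1)
  obtain ⟨i₀, hi₀⟩ := hs₀.nonempty
  have hs₀γ : s₀ < γ := hi₀.2 ▸ hsγ i₀ hi₀.1
  obtain ⟨B', h1, h2, X, hX⟩ := ih s₀ hs₀γ hs₀ fun i hi => hlim i hi.1.1.1
  refine ⟨B', fun i hi => (h1 hi).1.1.1, h2, X ∪ {s₀}, fun i hi => ?_⟩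
  rw [← hX i hi]
  have h3 := hsC i (h1 hi).1
  have h4 := hsmax i (h1 hi).1
  rw [(h1 hi).2] at h3 h4
  ext x
  constructor
  · rintro ⟨hx, hxγ⟩
    rcases (h4 x hx hxγ).lt_or_eq with h | h
    · exact Or.inl ⟨hx, h⟩
    · exact Or.inr h
  · rintro (hx | rfl)
    · exact ⟨hx.1, lt_trans hx.2 hs₀γ⟩
    · exact ⟨h3, hs₀γ⟩

namespace GapTree

section Run

variable {C : K → Set K} {E₀ : Set K} (p : GapTree C E₀) (ext : GapTree C E₀ → GapTree C E₀)

/-- The run along `L` with previous conditions `S` makes a move at `b`, replacing `c` by `ext c`. -/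
structure Move (L : Set K) (S : Set (GapTree C E₀)) (b : K) (c : GapTree C E₀) : Prop where
  carrier_eq : c.carrier = cl (points S) ∪ {c.top}
  top_mem : c.top ∈ L
  mem : b ∈ L
  top_lt : c.top < b
  le_of_mem : ∀ z ∈ L, c.top < z → b ≤ z
  lt_top : p.top < c.top
  ext_lt : ∃ e ∈ E₀, e < b ∧ (ext c).top < e

/-- The conditions chosen before stage `b` of the run along `L`. -/
def run (L : Set K) : K → Set (GapTree C E₀) :=
  WellFoundedLT.fix fun b S =>
    {d | d = p ∨ ∃ (b' : K) (h : b' < b) (c : GapTree C E₀), Move p ext L (S b' h) b' c ∧ d = ext c}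

variable {p ext}

theorem mem_run {L : Set K} {b : K} {d : GapTree C E₀} : d ∈ run p ext L b ↔
    d = p ∨ ∃ b' < b, ∃ c, Move p ext L (run p ext L b') b' c ∧ d = ext c := by
  rw [run, WellFoundedLT.fix_eq]
  simp only [Set.mem_ofPred_eq, exists_prop]

theorem self_mem_run {L : Set K} {b : K} : p ∈ run p ext L b := mem_run.2 (Or.inl rfl)

/-- Runs along different ladders agree as long as the ladders do; this is what makes Fodor's lemma
applicable to runs. -/
theorem run_congr {L L' : Set K} {b : K} (h : L ∩ Set.Iio b = L' ∩ Set.Iio b) :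
    run p ext L b = run p ext L' b := by
  induction b using WellFoundedLT.induction with
  | ind b ih =>
  have hmem : ∀ z < b, z ∈ L ↔ z ∈ L' := fun z hz => by
    have := Set.ext_iff.1 h z
    simpa [hz] using this
  ext d
  rw [mem_run, mem_run]
  refine or_congr Iff.rfl (exists_congr fun b' => and_congr_right fun hb' =>
    exists_congr fun c => and_congr_left fun _ => ?_)
  rw [ih b' hb' (by ext z; exact and_congr_left fun hz => hmem z (lt_trans hz hb'))]
  constructor
  · rintro ⟨h1, h2, h3, h4, h5, h6, h7⟩
    refine ⟨h1, (hmem _ (h4.trans hb')).1 h2, (hmem _ hb').1 h3, h4, fun z hz hlt => ?_, h6, h7⟩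
    by_contra hcon
    exact hcon (h5 z ((hmem z ((not_le.1 hcon).trans hb')).2 hz) hlt)
  · rintro ⟨h1, h2, h3, h4, h5, h6, h7⟩
    refine ⟨h1, (hmem _ (h4.trans hb')).2 h2, (hmem _ hb').2 h3, h4, fun z hz hlt => ?_, h6, h7⟩
    by_contra hcon
    exact hcon (h5 z ((hmem z ((not_le.1 hcon).trans hb')).1 hz) hlt)

theorem run_mono {L : Set K} {b b' : K} (h : b ≤ b') : run p ext L b ⊆ run p ext L b' := by
  intro d hd
  rw [mem_run] at hd ⊢
  exact hd.imp id fun ⟨b₁, h1, h2⟩ => ⟨b₁, h1.trans_le h, h2⟩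

theorem Move.ext_top_lt {L : Set K} {S : Set (GapTree C E₀)} {b : K} {c : GapTree C E₀}
    (h : Move p ext L S b c) : (ext c).top < b := by
  obtain ⟨e, -, h1, h2⟩ := h.ext_lt
  exact h2.trans h1

/-- `c.top` and `b` are consecutive in `L`, so an earlier move, made at a point of `L` below `b`,
was made at or below `c.top`. -/
theorem Move.points_lt {L : Set K} {b : K} {c : GapTree C E₀}
    (h : Move p ext L (run p ext L b) b c) : ∀ x ∈ points (run p ext L b), x < c.top := by
  intro x hx
  obtain ⟨d, hd, hxd⟩ := mem_points.1 hx
  rcases mem_run.1 hd with rfl | ⟨b', hb', c', h', rfl⟩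
  · exact (le_top hxd).trans_lt h.lt_top
  · refine ((le_top hxd).trans_lt h'.ext_top_lt).trans_le ?_
    by_contra hcon
    exact absurd (h.le_of_mem b' h'.mem (not_le.1 hcon)) (not_le.2 hb')

theorem Move.le_of_mem_run {L : Set K} {b : K} {c : GapTree C E₀}
    (h : Move p ext L (run p ext L b) b c) (hch : IsChain (· ≤ ·) (run p ext L b)) :
    ∀ d ∈ run p ext L b, d ≤ c := by
  intro d hd
  refine ⟨fun x hx => ?_, fun x hx y hy hxy => ?_⟩
  · rw [h.carrier_eq]; exact Or.inl (Or.inl (mem_points.2 ⟨d, hd, hx⟩))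
  · rw [h.carrier_eq] at hx
    rcases hx with hx | rfl
    · exact mem_of_le_of_mem_cl hch hd hx hy hxy
    · exact absurd (h.points_lt y (mem_points.2 ⟨d, hd, hy⟩)) (not_lt.2 hxy)

theorem Move.unique {L : Set K} {b : K} {c d : GapTree C E₀} {S : Set (GapTree C E₀)}
    (h : Move p ext L S b c) (h' : Move p ext L S b d) : c = d := by
  have : c.top = d.top := by
    rcases lt_trichotomy c.top d.top with hlt | heq | hlt
    · exact absurd (h.le_of_mem _ h'.top_mem hlt) (not_le.2 h'.top_lt)
    · exact heq
    · exact absurd (h'.le_of_mem _ h.top_mem hlt) (not_le.2 h.top_lt)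
  apply carrier_injective
  rw [h.carrier_eq, h'.carrier_eq, this]

variable (hext : ∀ c, c ≤ ext c)
include hext

theorem isChain_run (L : Set K) (b : K) : IsChain (· ≤ ·) (run p ext L b) := by
  induction b using WellFoundedLT.induction with
  | ind b ih =>
  have key : ∀ b' < b, ∀ c, Move p ext L (run p ext L b') b' c →
      ∀ d ∈ run p ext L b', d ≤ ext c := fun b' hb' c hc d hd =>
    (hc.le_of_mem_run (ih b' hb') d hd).trans (hext c)
  intro d hd d' hd' _
  rcases mem_run.1 hd with rfl | ⟨b₁, hb₁, c₁, h₁, rfl⟩ <;>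
    rcases mem_run.1 hd' with rfl | ⟨b₂, hb₂, c₂, h₂, rfl⟩
  · exact Or.inl le_rfl
  · exact Or.inl (key b₂ hb₂ c₂ h₂ _ self_mem_run)
  · exact Or.inr (key b₁ hb₁ c₁ h₁ _ self_mem_run)
  · rcases lt_trichotomy b₁ b₂ with h | rfl | h
    · exact Or.inl (key b₂ hb₂ c₂ h₂ _ (mem_run.2 (Or.inr ⟨b₁, h, c₁, h₁, rfl⟩)))
    · rw [h₁.unique h₂]; exact Or.inl le_rfl
    · exact Or.inr (key b₁ hb₁ c₁ h₁ _ (mem_run.2 (Or.inr ⟨b₂, h, c₂, h₂, rfl⟩)))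

theorem le_of_mem_run {L : Set K} {b : K} {d : GapTree C E₀} (hd : d ∈ run p ext L b) : p ≤ d := by
  rcases mem_run.1 hd with rfl | ⟨b', hb', c, h, rfl⟩
  · exact le_rfl
  · exact (h.le_of_mem_run (isChain_run hext L b') p self_mem_run).trans (hext c)

/-- A limit not belonging to the run exceeds the top of every condition in it. Passing from one
condition to a later one crosses the top of the condition being extended, a point of `L`. -/
theorem acc_or_of_acc_points {L : Set K} {b δ : K} (h : Acc (points (run p ext L b)) δ)
    (hδ : δ ∉ points (run p ext L b)) : p.top < δ ∧ Acc L δ := by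
  have hch := isChain_run hext (p := p) L b
  have hlt : ∀ d ∈ run p ext L b, d.top < δ := by
    intro d hd
    by_contra hcon
    exact hδ (mem_points.2 ⟨d, hd,
      mem_of_le_of_mem_cl hch hd (Or.inr h) d.top_mem (not_lt.1 hcon)⟩)
  refine ⟨hlt p self_mem_run, h.1, fun η hη => ?_⟩
  obtain ⟨u, hu, hu1, hu2⟩ := h.2 _ (max_lt hη (hlt p self_mem_run))
  obtain ⟨d, hd, hud⟩ := mem_points.1 hu
  obtain ⟨u', hu', hu1', hu2'⟩ := h.2 _ (hlt d hd)
  obtain ⟨d', hd', hud'⟩ := mem_points.1 hu'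
  rcases mem_run.1 hd with rfl | ⟨b₁, hb₁, c₁, h₁, rfl⟩
  · exact absurd (le_top hud) (not_le.2 ((le_max_right _ _).trans_lt hu1))
  rcases mem_run.1 hd' with rfl | ⟨b₂, hb₂, c₂, h₂, rfl⟩
  · exact absurd (le_top hud') (not_le.2 ((top_mono (le_of_mem_run hext hd)).trans_lt hu1'))
  have hb : b₁ < b₂ := by
    by_contra hcon
    rcases (not_lt.1 hcon).lt_or_eq with hlt' | rfl
    · have h3 := (h₁.le_of_mem_run (isChain_run hext L b₁) _
        (mem_run.2 (Or.inr ⟨b₂, hlt', c₂, h₂, rfl⟩))).trans (hext c₁)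
      exact absurd ((le_top hud').trans (top_mono h3)) (not_le.2 hu1')
    · rw [h₂.unique h₁] at hud'
      exact absurd (le_top hud') (not_le.2 hu1')
  refine ⟨c₂.top, h₂.top_mem, ?_, (top_mono (hext c₂)).trans_lt (hlt _ hd')⟩
  have h4 : b₁ ≤ c₂.top := by
    by_contra hcon
    exact absurd (h₂.le_of_mem _ h₁.mem (not_le.1 hcon)) (not_le.2 hb)
  exact (((le_max_left _ _).trans_lt hu1).trans_le (le_top hud)).trans (h₁.ext_top_lt.trans_le h4)

/-- Points enter as tops in `L`, as limits (which are limits of `L`), or through `ext c` inside a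
gap of `L`. In the last case the move requires a point of `E₀` between `(ext c).top` and the end of
the gap. -/
theorem new_points {L : Set K} {i : K} (hL : LadderAt C i) (hLi : L = C i) (b : K) :
    ∀ x ∈ points (run p ext L b), x ≤ p.top ∨ x ∈ L ∨
      ∃ e ∈ E₀, x < e ∧ ∀ z ∈ L, x ≤ z → e < z := by
  induction b using WellFoundedLT.induction with
  | ind b ih =>
  intro x hx
  obtain ⟨d, hd, hxd⟩ := mem_points.1 hx
  rcases mem_run.1 hd with rfl | ⟨b', hb', c, h, rfl⟩
  · exact Or.inl (le_top hxd)
  by_cases hxc : x ∈ c.carrier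
  · have hxtop := le_top hxc
    rw [h.carrier_eq] at hxc
    rcases hxc with (hxc | hxc) | hxc
    · exact ih b' hb' x hxc
    · by_cases hmem : x ∈ points (run p ext L b')
      · exact ih b' hb' x hmem
      · refine Or.inr (Or.inl ?_)
        have hacc := (acc_or_of_acc_points hext hxc hmem).2
        have hxi : x < i := hxtop.trans_lt (hL.subset (hLi ▸ h.top_mem))
        rw [hLi] at hacc ⊢
        exact hL.closed x hxi hacc
    · rw [Set.mem_singleton_iff] at hxc
      rw [hxc]; exact Or.inr (Or.inl h.top_mem)
  · right; right
    obtain ⟨e, he, heb, hte⟩ := h.ext_lt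
    have hlt : c.top < x := by
      by_contra hcon
      exact hxc ((hext c).2 x hxd _ c.top_mem (not_lt.1 hcon))
    exact ⟨e, he, (le_top hxd).trans_lt hte, fun z hz hxz =>
      heb.trans_le (h.le_of_mem z hz (hlt.trans_le hxz))⟩

/-- A new limit `δ` is a limit point of `C i` or `i` itself, so `C δ = C i ∩ Set.Iio δ`. By
`new_points`, a point of the run above `p.top` is then either in `C δ` or followed by a point of
`E₀` in its gap, so it is no gap end. -/
theorem exists_closure_run {i : K} (hL : LadderAt C i) {b γ : K}
    (hγ : ∀ x ∈ points (run p ext (C i) b), x < γ) :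
    ∃ d : GapTree C E₀, d.carrier = cl (points (run p ext (C i) b)) ∪ {γ} ∧ d.top = γ ∧
      ∀ c ∈ run p ext (C i) b, c ≤ d := by
  refine exists_closure (isChain_run hext _ b) hγ fun δ hδ hmem hacc => ?_
  obtain ⟨hpδ, hδL⟩ := acc_or_of_acc_points hext hδ hmem
  have hδi : δ ≤ i := by
    by_contra hcon
    obtain ⟨x, hx, h1, -⟩ := hδL.2 i (not_le.1 hcon)
    exact absurd (hL.subset hx) (not_lt.2 h1.le)
  have hCδ : C δ = C i ∩ Set.Iio δ := by
    rcases hδi.lt_or_eq with h | rfl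
    · exact hL.coherent δ h hδL
    · exact (Set.inter_eq_left.2 hL.subset).symm
  obtain ⟨x, ⟨hx, hxE, hxδ, β, hβ, hxβ, hβ1, hβ2⟩, hpx, -⟩ := hacc.2 _ hpδ
  rw [hCδ] at hβ hβ1
  rcases new_points hext hL rfl b x hx with h | h | ⟨e, he, hxe, h⟩
  · exact absurd h (not_le.2 hpx)
  · exact absurd (hβ1 x ⟨h, hxδ⟩ le_rfl) (not_le.2 hxβ)
  · exact absurd (hβ2 e he hxe) (not_le.2 (h β hβ.1 hxβ.le))

/-- If the moves along `C i` are cofinal in `i`, closing off the run gives a hit. Otherwise they are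
bounded for stationarily many `i`, and Fodor makes the bound `ζ₀` and the run `A` constant. A
suitable club is then contained in `C i` above `ζ₀`, since each of its points outside `C i` would
permit a further move. -/
theorem exists_hit [LargeRegular K] (hC : Unthreaded C) (hE₀ : IsClub E₀) {S : Set K}
    (hS : IsStationary S) :
    ∃ i ∈ S, ∃ q ≥ p, ∀ η < i, ∃ c ≥ p, ext c ≤ q ∧ η < c.top ∧ (ext c).top < i := by
  by_contra hcon
  let moves : K → Set K := fun i => {b | ∃ c, Move p ext (C i) (run p ext (C i) b) b c}
  let R := S ∩ {i | Acc (Set.Ioi p.top) i}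
  have hR : IsStationary R := isStationary_inter hS (isClub_acc (isClub_Ioi _))
  have hRp : ∀ i ∈ R, p.top < i := by
    intro i hi
    obtain ⟨⟨η, hη⟩, h⟩ := hi.2
    obtain ⟨x, hx, -, h2⟩ := h η hη
    exact lt_trans hx h2
  have hlim : ∀ i ∈ R, Lim i := fun i hi => hi.2.lim
  have hnacc : ∀ i ∈ R, ¬ Acc (moves i) i := by
    intro i hi hacc
    have hL := hC.ladder i (hlim i hi)
    refine hcon ⟨i, hi.1, ?_⟩
    obtain ⟨q, -, -, hq⟩ := exists_closure_run hext hL (p := p) (b := i) (γ := i) (fun x hx => by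
      obtain ⟨d, hd, hxd⟩ := mem_points.1 hx
      rcases mem_run.1 hd with rfl | ⟨b', hb', c', h', rfl⟩
      · exact (le_top hxd).trans_lt (hRp i hi)
      · exact ((le_top hxd).trans_lt h'.ext_top_lt).trans hb')
    refine ⟨q, hq p self_mem_run, fun η hη => ?_⟩
    obtain ⟨b₁, ⟨c₁, h₁⟩, hb₁, hb₁i⟩ := hacc.2 η hη
    obtain ⟨b₂, ⟨c₂, h₂⟩, hb₂, hb₂i⟩ := hacc.2 b₁ hb₁i
    refine ⟨c₂, h₂.le_of_mem_run (isChain_run hext _ _) p self_mem_run,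
      hq _ (mem_run.2 (Or.inr ⟨b₂, hb₂i, c₂, h₂, rfl⟩)), hb₁.trans_le ?_,
      h₂.ext_top_lt.trans hb₂i⟩
    by_contra hcon'
    exact absurd (h₂.le_of_mem _ h₁.mem (not_le.1 hcon')) (not_le.2 hb₂)
  have hζ : ∀ i ∈ R, ∃ ζ ∈ C i, ζ < i ∧ p.top < ζ ∧ ∀ b ∈ moves i, b < ζ := by
    intro i hi
    have hL := hC.ladder i (hlim i hi)
    have : ∃ η < i, ∀ b ∈ moves i, b ≤ η := by
      by_contra hcon'
      push Not at hcon'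
      refine hnacc i hi ⟨⟨_, hRp i hi⟩, fun η hη => ?_⟩
      obtain ⟨b, hb, hlt⟩ := hcon' η hη
      obtain ⟨c, hc⟩ := id hb
      exact ⟨b, hb, hlt, hL.subset hc.mem⟩
    obtain ⟨η, hη, h⟩ := this
    obtain ⟨ζ, hζ, h1, h2⟩ := hL.acc.2 _ (max_lt hη (hRp i hi))
    exact ⟨ζ, hζ, h2, (le_max_right _ _).trans_lt h1, fun b hb =>
      (h b hb).trans_lt ((le_max_left _ _).trans_lt h1)⟩
  choose! ζ hζC hζi hζp hζm using hζ
  obtain ⟨ζ₀, hR₁⟩ := fodor hR hζi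
  obtain ⟨R₂, hR₂, hstat, X, hX⟩ := exists_stationary_inter_Iio_const hC.ladder ζ₀ hR₁
    fun i hi => hlim i hi.1
  obtain ⟨i₀, hi₀⟩ := hstat.nonempty
  let A := run p ext (C i₀) ζ₀
  have hA : ∀ i ∈ R₂, ∀ b, ζ₀ ≤ b → run p ext (C i) b = A := by
    intro i hi b hb
    have h1 : run p ext (C i) ζ₀ = A := run_congr ((hX i hi).trans (hX i₀ hi₀).symm)
    rw [← h1]
    refine subset_antisymm (fun d hd => ?_) (run_mono hb)
    rcases mem_run.1 hd with rfl | ⟨b', hb', c', h', rfl⟩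
    · exact self_mem_run
    · have h2 := hζm i (hR₂ hi).1 b' ⟨c', h'⟩
      rw [(hR₂ hi).2] at h2
      exact mem_run.2 (Or.inr ⟨b', h2, c', h', rfl⟩)
  have hAlt : ∀ x ∈ points A, x < ζ₀ := by
    intro x hx
    obtain ⟨d, hd, hxd⟩ := mem_points.1 hx
    rcases mem_run.1 hd with rfl | ⟨b', hb', c', h', rfl⟩
    · have h2 := hζp i₀ (hR₂ hi₀).1
      rw [(hR₂ hi₀).2] at h2
      exact (le_top hxd).trans_lt h2
    · exact ((le_top hxd).trans_lt h'.ext_top_lt).trans hb'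
  -- The condition from which a move with predecessor `γ` in the ladder would start; it depends on
  -- `γ` alone, not on `i`.
  have hd : ∀ γ, ∃ d : GapTree C E₀, ζ₀ ≤ γ → d.carrier = cl (points A) ∪ {γ} ∧ d.top = γ := by
    intro γ
    by_cases hγ : ζ₀ ≤ γ
    · obtain ⟨d, h1, h2, -⟩ := exists_closure_run hext (hC.ladder i₀ (hlim _ (hR₂ hi₀).1))
        (b := ζ₀) (γ := γ) fun x hx => (hAlt x hx).trans_le hγ
      exact ⟨d, fun _ => ⟨h1, h2⟩⟩
    · exact ⟨p, fun h => absurd h hγ⟩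
  choose d hd using hd
  have hclub := isClub_inter hE₀ (isClub_closurePoints fun γ => (ext (d γ)).top)
  refine hC.false_of_tails hclub hstat (fun _ => ζ₀) fun i hi => ⟨hlim i (hR₂ hi).1, ?_, ?_⟩
  · have h2 := hζi i (hR₂ hi).1
    rwa [(hR₂ hi).2] at h2
  rintro x ⟨hxE₀, hx⟩ hζx hxi
  by_contra hxC
  have hL := hC.ladder i (hlim i (hR₂ hi).1)
  have hζ₀C : ζ₀ ∈ C i := by
    have h2 := hζC i (hR₂ hi).1
    rwa [(hR₂ hi).2] at h2
  have hζ₀p : p.top < ζ₀ := by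
    have h2 := hζp i (hR₂ hi).1
    rwa [(hR₂ hi).2] at h2
  obtain ⟨β, ⟨hβC, hxβ⟩, hmin⟩ := exists_least (s := {β | β ∈ C i ∧ x < β}) (by
    obtain ⟨β, hβ, h, -⟩ := hL.acc.2 x hxi
    exact ⟨β, hβ, h⟩)
  obtain ⟨γ, hγC, hγx, hγmax⟩ : ∃ y ∈ C i, y < x ∧ ∀ z ∈ C i, z < x → z ≤ y :=
    exists_max_lt (fun h => hxC (hL.closed x hxi h)) hζ₀C hζx
      fun b hb => hL.closed b (hb.trans hxi)
  have hζγ : ζ₀ ≤ γ := hγmax ζ₀ hζ₀C hζx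
  obtain ⟨h1, h2⟩ := hd γ hζγ
  -- `γ` and `β` are the neighbours of `x` in `C i`. As a closure point, `x` exceeds `(ext (d
  -- γ)).top`, so it is the point of `E₀` that the move needs.
  have hmove : β ∈ moves i := by
    refine ⟨d γ, ?_, ?_, hβC, ?_, ?_, ?_, x, hxE₀, hxβ, hx γ hγx⟩
    · rw [hA i hi β (hζx.trans hxβ).le, h1, h2]
    · rwa [h2]
    · rw [h2]; exact hγx.trans hxβ
    · rw [h2]
      intro z hz hγz
      refine hmin z ⟨hz, ?_⟩
      by_contra hcon'
      rcases (not_lt.1 hcon').lt_or_eq with h | h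
      · exact absurd (hγmax z hz h) (not_le.2 hγz)
      · exact hxC (h ▸ hz)
    · rw [h2]; exact hζ₀p.trans_le hζγ
  have h3 := hζm i (hR₂ hi).1 β hmove
  rw [(hR₂ hi).2] at h3
  exact absurd h3 (not_lt.2 (hζx.trans hxβ).le)

end Run

end GapTree

end LargeRegular

/-! ### The tree of labelled ladder systems -/

namespace LargeRegular

variable {K : Type u} [LinearOrder K] [WellFoundedLT K]

theorem LadderAt.congr {C D : K → Set K} {i : K} (h : LadderAt C i) (hCD : ∀ j ≤ i, D j = C j) :
    LadderAt D i := by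
  have hi := hCD i le_rfl
  refine ⟨hi ▸ h.subset, hi ▸ h.acc, hi ▸ h.closed, hi ▸ h.nacc, fun j hj hacc => ?_⟩
  rw [hi] at hacc ⊢
  rw [hCD j hj.le, h.coherent j hj hacc]

/-- The condition on the labels of the limit points of `C i`. -/
def LabelAt (C A : K → Set K) (i : K) : Prop := ∀ j < i, Acc (C i) j → A j = A i ∧ j ∉ A i

theorem LabelAt.congr {C A D B : K → Set K} {i : K} (h : LabelAt C A i)
    (hCD : ∀ j ≤ i, D j = C j) (hAB : ∀ j ≤ i, B j = A j) : LabelAt D B i := by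
  intro j hj hacc
  rw [hCD i le_rfl] at hacc
  rw [hAB i le_rfl, hAB j hj.le]
  exact h j hj hacc

/-- Initial segments of coherent systems of clubs, labelled by stationary sets in such a way that
the label is constant along the limit points of a club, and is avoided by them. -/
structure LadderTree (K : Type u) [LinearOrder K] [WellFoundedLT K] where
  top : K
  C : K → Set K
  A : K → Set K
  -- Default values above `top` make a condition determined by its data up to `top`, as antisymmetry
  -- of end-extension requires.
  C_of_lt : ∀ i, top < i → C i = ∅
  A_of_lt : ∀ i, top < i → A i = ∅
  stationary : ∀ i ≤ top, IsStationary (A i)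
  ladder : ∀ i ≤ top, Lim i → LadderAt C i
  label : ∀ i ≤ top, Lim i → LabelAt C A i

namespace LadderTree

theorem data_injective :
    Function.Injective fun p : LadderTree K => (p.top, p.C, p.A) := by
  rintro ⟨⟩ ⟨⟩ h
  simpa using h

theorem mk_le [Infinite K] : #(LadderTree K) ≤ 2 ^ #K := by
  refine (mk_le_of_injective data_injective).trans ?_
  have hK : ℵ₀ ≤ #K := aleph0_le_mk K
  have h2 : ℵ₀ ≤ 2 ^ #K := hK.trans (cantor _).le
  have h1 : #(K → Set K) = 2 ^ #K := by
    rw [mk_arrow, lift_id, lift_id, mk_set, ← power_mul, mul_eq_self hK]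
  simp only [mk_prod, lift_id]
  rw [h1, mul_eq_self h2]
  exact (mul_le_max_of_aleph0_le_right h2).trans (max_le (cantor _).le le_rfl)

/-- End-extension. -/
instance : PartialOrder (LadderTree K) where
  le p q := p.top ≤ q.top ∧ ∀ i ≤ p.top, q.C i = p.C i ∧ q.A i = p.A i
  le_refl p := ⟨le_rfl, fun _ _ => ⟨rfl, rfl⟩⟩
  le_trans p q r hpq hqr := ⟨hpq.1.trans hqr.1, fun i hi =>
    ⟨(hqr.2 i (hi.trans hpq.1)).1.trans (hpq.2 i hi).1,
      (hqr.2 i (hi.trans hpq.1)).2.trans (hpq.2 i hi).2⟩⟩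
  le_antisymm p q hpq hqp := by
    have ht : p.top = q.top := le_antisymm hpq.1 hqp.1
    have h : ∀ i, q.C i = p.C i ∧ q.A i = p.A i := by
      intro i
      rcases le_or_gt i p.top with hi | hi
      · exact hpq.2 i hi
      · rw [p.C_of_lt i hi, p.A_of_lt i hi, q.C_of_lt i (ht ▸ hi), q.A_of_lt i (ht ▸ hi)]
        exact ⟨rfl, rfl⟩
    exact data_injective (Prod.ext ht (Prod.ext (funext fun i => (h i).1.symm)
      (funext fun i => (h i).2.symm)))

theorem top_strictMono : StrictMono (top : LadderTree K → K) := by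
  intro p q h
  refine lt_of_le_of_ne h.le.1 fun heq => h.not_ge ⟨heq.ge, fun i hi => ?_⟩
  have := h.le.2 i (heq ▸ hi)
  exact ⟨this.1.symm, this.2.symm⟩

theorem le_total_of_le {a b c : LadderTree K} (ha : a ≤ c) (hb : b ≤ c) : a ≤ b ∨ b ≤ a := by
  rcases le_total a.top b.top with h | h
  · exact Or.inl ⟨h, fun i hi => ⟨(hb.2 i (hi.trans h)).1.symm.trans (ha.2 i hi).1,
      (hb.2 i (hi.trans h)).2.symm.trans (ha.2 i hi).2⟩⟩
  · exact Or.inr ⟨h, fun i hi => ⟨(ha.2 i (hi.trans h)).1.symm.trans (hb.2 i hi).1,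
      (ha.2 i (hi.trans h)).2.symm.trans (hb.2 i hi).2⟩⟩

theorem not_lim_of_forall_le {m : K} (hm : ∀ z, m ≤ z) : ¬ Lim m := by
  rintro ⟨⟨η, hη⟩, -⟩
  exact absurd (hm η) (not_le.2 hη)

section Regular

variable [hK : LargeRegular K]

instance : Nonempty (LadderTree K) := by
  obtain ⟨m, -, hm⟩ := exists_least (Set.univ_nonempty (α := K))
  have hlim : ∀ i ≤ m, ¬ Lim i := fun i hi => not_lim_of_forall_le fun z => hi.trans (hm z trivial)
  refine ⟨⟨m, fun _ => ∅, fun i => {_x | i ≤ m}, fun _ _ => rfl, fun i hi => ?_, fun i hi => ?_,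
    fun i hi h => absurd h (hlim i hi), fun i hi h => absurd h (hlim i hi)⟩⟩
  · ext; simpa using hi
  · have : {_x : K | i ≤ m} = Set.univ := by ext; simpa using hi
    rw [this]; exact IsStationary.univ

-- Above the old top use intervals as clubs. Their limit points lie above `p.top`, so old labels
-- impose nothing, and the new label `Set.Ioi ζ` avoids every point up to `ζ`.
open Classical in
theorem exists_top_eq (p : LadderTree K) {ζ : K} (hζ : p.top < ζ) :
    ∃ q ≥ p, q.top = ζ := by
  let D : K → Set K := fun i => if i ≤ p.top then p.C i else if i ≤ ζ then Set.Ioo p.top i else ∅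
  let B : K → Set K := fun i => if i ≤ p.top then p.A i else if i ≤ ζ then Set.Ioi ζ else ∅
  have hD1 : ∀ i ≤ p.top, D i = p.C i := fun i hi => if_pos hi
  have hB1 : ∀ i ≤ p.top, B i = p.A i := fun i hi => if_pos hi
  have hD2 : ∀ i, p.top < i → i ≤ ζ → D i = Set.Ioo p.top i := fun i h1 h2 => by
    simp only [D, if_neg (not_le.2 h1), if_pos h2]
  have hB2 : ∀ i, p.top < i → i ≤ ζ → B i = Set.Ioi ζ := fun i h1 h2 => by
    simp only [B, if_neg (not_le.2 h1), if_pos h2]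
  have hgt : ∀ i j, Acc (Set.Ioo p.top i) j → p.top < j ∧ j ≤ i := by
    intro i j h
    obtain ⟨η, hη⟩ := h.1
    obtain ⟨x, hx, h1, h2⟩ := h.2 η hη
    refine ⟨hx.1.trans h2, ?_⟩
    by_contra hcon
    obtain ⟨y, hy, h3, h4⟩ := h.2 i (not_le.1 hcon)
    exact absurd hy.2 (not_lt.2 h3.le)
  have haccI : ∀ i β, p.top < β → β ≤ i → Lim β → Acc (Set.Ioo p.top i) β := by
    intro i β h1 h2 h
    refine ⟨h.1, fun η hη => ?_⟩
    obtain ⟨x, -, h3, h4⟩ := h.2 _ (max_lt hη h1)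
    exact ⟨x, ⟨(le_max_right _ _).trans_lt h3, h4.trans_le h2⟩, (le_max_left _ _).trans_lt h3, h4⟩
  refine ⟨⟨ζ, D, B, fun i hi => ?_, fun i hi => ?_, fun i hi => ?_, fun i hi hlim => ?_,
    fun i hi hlim => ?_⟩, ⟨hζ.le, fun i hi => ⟨hD1 i hi, hB1 i hi⟩⟩, rfl⟩
  · simp only [D, if_neg (not_le.2 (hζ.trans hi)), if_neg (not_le.2 hi)]
  · simp only [B, if_neg (not_le.2 (hζ.trans hi)), if_neg (not_le.2 hi)]
  · rcases le_or_gt i p.top with h | h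
    · rw [hB1 i h]; exact p.stationary i h
    · rw [hB2 i h hi]; exact (isClub_Ioi ζ).isStationary cof_ne_aleph0
  · rcases le_or_gt i p.top with h | h
    · exact (p.ladder i h hlim).congr fun j hj => hD1 j (hj.trans h)
    · have hDi := hD2 i h hi
      refine ⟨?_, ?_, ?_, ?_, ?_⟩ <;> rw [hDi]
      · exact fun x hx => hx.2
      · exact haccI i i h le_rfl hlim
      · exact fun δ hδ hacc => ⟨(hgt i δ hacc).1, hδ⟩
      · exact fun β hβ hl => haccI i β hβ.1 hβ.2.le hl
      · intro j hj hacc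
        have := (hgt i j hacc).1
        rw [hD2 j this (hj.le.trans hi)]
        ext x
        exact ⟨fun hx => ⟨⟨hx.1, hx.2.trans hj⟩, hx.2⟩, fun hx => ⟨hx.1.1, hx.2⟩⟩
  · rcases le_or_gt i p.top with h | h
    · exact (p.label i h hlim).congr (fun j hj => hD1 j (hj.trans h)) fun j hj => hB1 j (hj.trans h)
    · intro j hj hacc
      rw [hD2 i h hi] at hacc
      have h3 := (hgt i j hacc).1
      rw [hB2 i h hi, hB2 j h3 (hj.le.trans hi)]
      exact ⟨rfl, not_lt.2 (hj.le.trans hi)⟩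

section Chain

variable {S : Set (LadderTree K)} (hS : IsChain (· ≤ ·) S)

/-- The union of the clubs of a set of conditions. -/
def unionC (S : Set (LadderTree K)) (i : K) : Set K := ⋃ c ∈ S, c.C i

/-- The union of the labels of a set of conditions. -/
def unionA (S : Set (LadderTree K)) (i : K) : Set K := ⋃ c ∈ S, c.A i

include hS in
theorem unionC_eq {c : LadderTree K} (hc : c ∈ S) {i : K} (hi : i ≤ c.top) :
    unionC S i = c.C i := by
  refine subset_antisymm (Set.iUnion₂_subset fun d hd => ?_)
    (Set.subset_biUnion_of_mem (u := fun c => c.C i) hc)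
  rcases hS.total hc hd with h | h
  · rw [(h.2 i hi).1]
  · rcases le_or_gt i d.top with hid | hid
    · rw [(h.2 i hid).1]
    · rw [d.C_of_lt i hid]; exact Set.empty_subset _

include hS in
theorem unionA_eq {c : LadderTree K} (hc : c ∈ S) {i : K} (hi : i ≤ c.top) :
    unionA S i = c.A i := by
  refine subset_antisymm (Set.iUnion₂_subset fun d hd => ?_)
    (Set.subset_biUnion_of_mem (u := fun c => c.A i) hc)
  rcases hS.total hc hd with h | h
  · rw [(h.2 i hi).2]
  · rcases le_or_gt i d.top with hid | hid
    · rw [(h.2 i hid).2]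
    · rw [d.A_of_lt i hid]; exact Set.empty_subset _

include hS in
/-- A chain without an upper bound for its heights yields a coherent system without a thread. -/
theorem unthreaded_unionC (hub : ∀ b, ∃ c ∈ S, b ≤ c.top) : Unthreaded (unionC S) := by
  have hC : ∀ c ∈ S, ∀ i ≤ c.top, ∀ j ≤ i, unionC S j = c.C j := fun c hc i hi j hj =>
    unionC_eq hS hc (hj.trans hi)
  have hA : ∀ c ∈ S, ∀ i ≤ c.top, ∀ j ≤ i, unionA S j = c.A j := fun c hc i hi j hj =>
    unionA_eq hS hc (hj.trans hi)
  have hlabel : ∀ i, Lim i → LabelAt (unionC S) (unionA S) i := by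
    intro i hi
    obtain ⟨c, hc, hic⟩ := hub i
    exact (c.label i hic hi).congr (hC c hc i hic) (hA c hc i hic)
  refine ⟨fun i hi => ?_, fun T hT hth => ?_⟩
  · obtain ⟨c, hc, hic⟩ := hub i
    exact (c.ladder i hic hi).congr (hC c hc i hic)
  have key : ∀ j j', Acc T j → Acc T j' → j < j' →
      unionA S j = unionA S j' ∧ j ∉ unionA S j' := by
    intro j j' hj hj' hlt
    refine hlabel j' hj'.lim j hlt ?_
    rw [hth j' hj']
    exact hj.inter_Iio hlt.le
  have hclub := isClub_acc_of_unbounded hT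
  obtain ⟨j₀, hj₀⟩ := hclub.isCofinal.nonempty
  obtain ⟨c, hc, hjc⟩ := hub j₀
  have hst : IsStationary (unionA S j₀) := by
    rw [unionA_eq hS hc hjc]; exact c.stationary j₀ hjc
  -- Along the limit points of a thread the label is constant and avoids those points; being
  -- stationary, it nevertheless meets the club they form.
  obtain ⟨j, hjA, hj⟩ := isStationary_Ioi_inter hst j₀ hclub
  obtain ⟨j', hj', hlt⟩ := (isClub_iff_acc.1 hclub).2 j
  have h1 := (key j₀ j' hj₀ hj' (lt_trans hjA.2 hlt)).1
  exact (key j j' hj hj' hlt).2 (h1 ▸ hjA.1)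

include hS in
open Classical in
/-- Put a new top on a chain. -/
theorem exists_limit {δ : K} (hne : ∀ η < δ, ∃ c ∈ S, η < c.top) (hlt : ∀ c ∈ S, c.top < δ)
    {L B : Set K} (hB : IsStationary B)
    (hL : LadderAt (Function.update (unionC S) δ L) δ)
    (hlab : LabelAt (Function.update (unionC S) δ L) (Function.update (unionA S) δ B) δ) :
    ∃ q : LadderTree K, q.top = δ ∧ q.C δ = L ∧ q.A δ = B ∧ ∀ c ∈ S, c ≤ q := by
  have hC : ∀ c ∈ S, ∀ j ≤ c.top, Function.update (unionC S) δ L j = c.C j := by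
    intro c hc j hj
    rw [Function.update_of_ne (hj.trans_lt (hlt c hc)).ne, unionC_eq hS hc hj]
  have hA : ∀ c ∈ S, ∀ j ≤ c.top, Function.update (unionA S) δ B j = c.A j := by
    intro c hc j hj
    rw [Function.update_of_ne (hj.trans_lt (hlt c hc)).ne, unionA_eq hS hc hj]
  refine ⟨⟨δ, Function.update (unionC S) δ L, Function.update (unionA S) δ B, fun i hi => ?_,
    fun i hi => ?_, fun i hi => ?_, fun i hi hlim => ?_, fun i hi hlim => ?_⟩, rfl, ?_, ?_,
    fun c hc => ⟨(hlt c hc).le, fun i hi => ⟨hC c hc i hi, hA c hc i hi⟩⟩⟩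
  · rw [Function.update_of_ne hi.ne']
    simp only [unionC, Set.iUnion_eq_empty]
    exact fun c hc => c.C_of_lt i ((hlt c hc).trans hi)
  · rw [Function.update_of_ne hi.ne']
    simp only [unionA, Set.iUnion_eq_empty]
    exact fun c hc => c.A_of_lt i ((hlt c hc).trans hi)
  · rcases hi.lt_or_eq with h | rfl
    · obtain ⟨c, hc, hic⟩ := hne i h
      rw [hA c hc i hic.le]; exact c.stationary i hic.le
    · rwa [Function.update_self]
  · rcases hi.lt_or_eq with h | rfl
    · obtain ⟨c, hc, hic⟩ := hne i h
      exact (c.ladder i hic.le hlim).congr fun j hj => hC c hc j (hj.trans hic.le)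
    · exact hL
  · rcases hi.lt_or_eq with h | rfl
    · obtain ⟨c, hc, hic⟩ := hne i h
      exact (c.label i hic.le hlim).congr (fun j hj => hC c hc j (hj.trans hic.le))
        fun j hj => hA c hc j (hj.trans hic.le)
    · exact hlab
  · exact Function.update_self ..
  · exact Function.update_self ..

end Chain

/-! ### Runs of a strategy in the tree of ladder systems -/

section Run

/-- `d` continues the run consisting of the conditions `r ζ` for `ζ < ξ`. -/
structure Continues (p : LadderTree K) (ext : LadderTree K → LadderTree K) (B : Set K) (ξ : K)
    (r : ∀ ζ < ξ, LadderTree K) (d : LadderTree K) : Prop where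
  lt : p < d
  ext_lt : ∀ ζ hζ, ext (r ζ hζ) < d
  not_lim : ¬ Lim ξ → ¬ Lim d.top
  lub : Lim ξ → ∀ η < d.top, ∃ ζ hζ, η < (r ζ hζ).top
  C_eq : Lim ξ → d.C d.top = {x | ∃ ζ hζ, x = (r ζ hζ).top}
  A_eq : Lim ξ → d.A d.top = B

open Classical in
/-- A run of the game in which `ext` is applied at each step. -/
noncomputable def run (p : LadderTree K) (ext : LadderTree K → LadderTree K) (B : Set K) :
    K → LadderTree K :=
  WellFoundedLT.fix fun ξ r => if h : ∃ d, Continues p ext B ξ r d then h.choose else p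

variable {p : LadderTree K} {ext : LadderTree K → LadderTree K} {B : Set K}

theorem continues_run {ξ : K} (h : ∃ d, Continues p ext B ξ (fun ζ _ => run p ext B ζ) d) :
    Continues p ext B ξ (fun ζ _ => run p ext B ζ) (run p ext B ξ) := by
  have : run p ext B ξ = h.choose := (WellFoundedLT.fix_eq _ ξ).trans (dif_pos h)
  rw [this]
  exact h.choose_spec

theorem exists_not_lim_gt (η : K) : ∃ ζ, η < ζ ∧ ¬ Lim ζ := by
  obtain ⟨ζ, hζ, hmin⟩ := exists_least (s := Set.Ioi η) (exists_gt η)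
  refine ⟨ζ, hζ, fun h => ?_⟩
  obtain ⟨x, -, h1, h2⟩ := h.2 η hζ
  exact absurd (hmin x h1) (not_le.2 h2)

/-- At a limit stage the earlier tops form the club and `B` is the label. The limit points of that
club are the tops at earlier limit stages, which carry the same construction and the same label; the
hypothesis keeps them out of `B`. -/
theorem continues_run_of_forall_notMem (hext : ∀ c, c ≤ ext c) (hB : IsStationary B) {ξ : K}
    (hξ : ∀ ζ < ξ, Lim ζ → (run p ext B ζ).top ∉ B) :
    Continues p ext B ξ (fun ζ _ => run p ext B ζ) (run p ext B ξ) := by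
  induction ξ using WellFoundedLT.induction with
  | ind ξ ih =>
  have ih' : ∀ ζ < ξ, Continues p ext B ζ (fun ζ _ => run p ext B ζ) (run p ext B ζ) :=
    fun ζ hζ => ih ζ hζ fun ζ' hζ' => hξ ζ' (hζ'.trans hζ)
  have hstep : ∀ ζ ζ', ζ < ζ' → ζ' < ξ → ext (run p ext B ζ) < run p ext B ζ' :=
    fun ζ ζ' h h' => (ih' ζ' h').ext_lt ζ h
  have hmono : ∀ ζ ζ', ζ < ζ' → ζ' < ξ → run p ext B ζ < run p ext B ζ' :=
    fun ζ ζ' h h' => (hext _).trans_lt (hstep ζ ζ' h h')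
  apply continues_run
  by_cases hlim : Lim ξ
  swap
  · have hmax : ∃ d ≥ p, ∀ ζ < ξ, ext (run p ext B ζ) ≤ d := by
      by_cases h : ∃ η, η < ξ
      · obtain ⟨η, hη⟩ := h
        obtain ⟨ζ, -, hζ, hmax⟩ := exists_max_lt hlim (Set.mem_univ η) hη fun _ _ _ => trivial
        refine ⟨ext (run p ext B ζ), (ih' ζ hζ).lt.le.trans (hext _), fun ζ' hζ' => ?_⟩
        rcases (hmax ζ' trivial hζ').lt_or_eq with h | rfl
        · exact (hstep ζ' ζ h hζ).le.trans (hext _)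
        · exact le_rfl
      · exact ⟨p, le_rfl, fun ζ hζ => absurd ⟨ζ, hζ⟩ h⟩
    obtain ⟨d, hpd, hd⟩ := hmax
    -- At non-limit stages the top is chosen not to be a limit, so any limit among the tops comes
    -- from a limit stage and is a limit of earlier tops, as `LadderAt.nacc` demands.
    obtain ⟨ζ, hζ, hζl⟩ := exists_not_lim_gt d.top
    obtain ⟨q, hq, rfl⟩ := exists_top_eq d hζ
    have hdq : d < q := lt_of_le_of_ne hq fun h => absurd hζ (h ▸ lt_irrefl _)
    exact ⟨q, hpd.trans_lt hdq, fun ζ hζ => (hd ζ hζ).trans_lt hdq, fun _ => hζl,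
      fun h => absurd h hlim, fun h => absurd h hlim, fun h => absurd h hlim⟩
  let S : Set (LadderTree K) := {d | ∃ ζ < ξ, d = run p ext B ζ}
  let L : Set K := {x | ∃ ζ, ∃ _ : ζ < ξ, x = (run p ext B ζ).top}
  have hS : IsChain (· ≤ ·) S := by
    rintro _ ⟨ζ, hζ, rfl⟩ _ ⟨ζ', hζ', rfl⟩ hne
    rcases lt_trichotomy ζ ζ' with h | rfl | h
    · exact Or.inl (hmono _ _ h hζ').le
    · exact absurd rfl hne
    · exact Or.inr (hmono _ _ h hζ).le
  have htop : ∀ ζ ζ', ζ < ζ' → ζ' < ξ → (run p ext B ζ).top < (run p ext B ζ').top :=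
    fun ζ ζ' h h' => top_strictMono (hmono ζ ζ' h h')
  have htop' : ∀ ζ ζ', ζ < ξ → ζ' < ξ → (run p ext B ζ).top < (run p ext B ζ').top → ζ < ζ' := by
    intro ζ ζ' h h' hlt
    rcases lt_trichotomy ζ ζ' with h1 | rfl | h1
    · exact h1
    · exact absurd hlt (lt_irrefl _)
    · exact absurd hlt (htop _ _ h1 h).not_gt
  obtain ⟨δ, hδ, hδmin⟩ := exists_least (s := {δ | ∀ ζ < ξ, (run p ext B ζ).top < δ}) (by
    obtain ⟨b, hb⟩ := hK.bounded (fun ζ : Set.Iio ξ => (run p ext B ζ).top) (hK.mk_Iio_lt ξ)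
    exact ⟨b, fun ζ hζ => hb ⟨ζ, hζ⟩⟩)
  have hlub : ∀ η < δ, ∃ ζ < ξ, η < (run p ext B ζ).top := by
    intro η hη
    by_contra hcon
    push Not at hcon
    refine absurd (hδmin η fun ζ hζ => ?_) (not_le.2 hη)
    obtain ⟨ζ', -, h1, h2⟩ := hlim.2 ζ hζ
    exact (htop ζ ζ' h1 h2).trans_le (hcon ζ' h2)
  obtain ⟨ζ₀, hζ₀⟩ := hlim.1
  have hLδ : L ⊆ Set.Iio δ := by
    rintro _ ⟨ζ, hζ, rfl⟩
    exact hδ ζ hζ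
  have haccL : Acc L δ := ⟨⟨_, hδ ζ₀ hζ₀⟩, fun η hη => by
    obtain ⟨ζ, hζ, h⟩ := hlub η hη
    exact ⟨_, ⟨ζ, hζ, rfl⟩, h, hδ ζ hζ⟩⟩
  have hLtop : ∀ ζ < ξ, Lim ζ → (run p ext B ζ).C (run p ext B ζ).top =
      L ∩ Set.Iio (run p ext B ζ).top := by
    intro ζ hζ hl
    rw [(ih' ζ hζ).C_eq hl]
    ext x
    constructor
    · rintro ⟨ζ', hζ', rfl⟩
      exact ⟨⟨ζ', hζ'.trans hζ, rfl⟩, htop _ _ hζ' hζ⟩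
    · rintro ⟨⟨ζ', hζ', rfl⟩, hlt⟩
      exact ⟨ζ', htop' _ _ hζ' hζ hlt, rfl⟩
  have haccT : ∀ ζ < ξ, Lim ζ → Acc L (run p ext B ζ).top := by
    intro ζ hζ hl
    obtain ⟨ζ', hζ'⟩ := hl.1
    refine ⟨⟨_, htop ζ' ζ hζ' hζ⟩, fun η hη => ?_⟩
    obtain ⟨ζ₁, hζ₁, h⟩ := (ih' ζ hζ).lub hl η hη
    exact ⟨_, ⟨ζ₁, hζ₁.trans hζ, rfl⟩, h, htop ζ₁ ζ hζ₁ hζ⟩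
  -- The first stage whose top reaches `j` is a limit stage, and by continuity its top is exactly
  -- `j`.
  have hacc : ∀ j < δ, Acc L j → ∃ ζ < ξ, Lim ζ ∧ j = (run p ext B ζ).top := by
    intro j hj hacc
    obtain ⟨ζ, ⟨hζ, hjζ⟩, hmin⟩ := exists_least (s := {ζ | ζ < ξ ∧ j ≤ (run p ext B ζ).top}) (by
      obtain ⟨ζ, hζ, h⟩ := hlub j hj
      exact ⟨ζ, hζ, h.le⟩)
    have hbelow : ∀ ζ' < ζ, (run p ext B ζ').top < j := by
      intro ζ' hζ'
      by_contra hcon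
      exact absurd (hmin ζ' ⟨hζ'.trans hζ, not_lt.1 hcon⟩) (not_le.2 hζ')
    have hinv : ∀ ζ' < ξ, (run p ext B ζ').top < j → ζ' < ζ := by
      intro ζ' hζ' h
      exact htop' ζ' ζ hζ' hζ (h.trans_le hjζ)
    have hl : Lim ζ := by
      obtain ⟨η, hη⟩ := hacc.1
      obtain ⟨_, ⟨ζ₁, hζ₁, rfl⟩, -, h2⟩ := hacc.2 η hη
      refine ⟨⟨ζ₁, hinv ζ₁ hζ₁ h2⟩, fun ζ' hζ' => ?_⟩
      obtain ⟨_, ⟨ζ₂, hζ₂, rfl⟩, h3, h4⟩ := hacc.2 _ (hbelow ζ' hζ')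
      exact ⟨ζ₂, trivial, htop' _ _ (hζ'.trans hζ) hζ₂ h3, hinv ζ₂ hζ₂ h4⟩
    refine ⟨ζ, hζ, hl, le_antisymm hjζ ?_⟩
    by_contra hcon
    obtain ⟨ζ₁, hζ₁, h⟩ := (ih' ζ hζ).lub hl j (not_le.1 hcon)
    exact absurd h (hbelow ζ₁ hζ₁).not_gt
  have hU : ∀ ζ < ξ, unionC S (run p ext B ζ).top = (run p ext B ζ).C (run p ext B ζ).top :=
    fun ζ hζ => unionC_eq hS ⟨ζ, hζ, rfl⟩ le_rfl
  have hUA : ∀ ζ < ξ, unionA S (run p ext B ζ).top = (run p ext B ζ).A (run p ext B ζ).top :=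
    fun ζ hζ => unionA_eq hS ⟨ζ, hζ, rfl⟩ le_rfl
  obtain ⟨q, rfl, hqC, hqA, hq⟩ := exists_limit hS (δ := δ) (L := L) (B := B)
    (fun η hη => by
      obtain ⟨ζ, hζ, h⟩ := hlub η hη
      exact ⟨_, ⟨ζ, hζ, rfl⟩, h⟩)
    (by rintro _ ⟨ζ, hζ, rfl⟩; exact hδ ζ hζ) hB
    (by
      refine ⟨?_, ?_, ?_, ?_, ?_⟩ <;> rw [Function.update_self]
      · exact hLδ
      · exact haccL
      · intro j hj h
        obtain ⟨ζ, hζ, -, rfl⟩ := hacc j hj h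
        exact ⟨ζ, hζ, rfl⟩
      · rintro _ ⟨ζ, hζ, rfl⟩ hl
        refine haccT ζ hζ ?_
        by_contra hcon
        exact (ih' ζ hζ).not_lim hcon hl
      · intro j hj h
        obtain ⟨ζ, hζ, hl, rfl⟩ := hacc j hj h
        rw [Function.update_of_ne hj.ne, hU ζ hζ, hLtop ζ hζ hl])
    (by
      intro j hj h
      rw [Function.update_self] at h
      obtain ⟨ζ, hζ, hl, rfl⟩ := hacc j hj h
      rw [Function.update_self, Function.update_of_ne hj.ne, hUA ζ hζ, (ih' ζ hζ).A_eq hl]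
      exact ⟨rfl, hξ ζ hζ hl⟩)
  have hlt : ∀ ζ < ξ, ext (run p ext B ζ) < q := by
    intro ζ hζ
    obtain ⟨ζ', -, h1, h2⟩ := hlim.2 ζ hζ
    exact (hstep ζ ζ' h1 h2).trans_le (hq _ ⟨ζ', h2, rfl⟩)
  refine ⟨q, (ih' ζ₀ hζ₀).lt.trans_le (hq _ ⟨ζ₀, hζ₀, rfl⟩), hlt, fun h => absurd hlim h,
    fun _ η hη => ?_, fun _ => hqC, fun _ => hqA⟩
  obtain ⟨ζ, hζ, h⟩ := hlub η hη
  exact ⟨ζ, hζ, h⟩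

/-- If limit stages always avoided `B`, the run would never stop, and its continuous increasing tops
would have a fixed point in `B` at a limit. At the first limit stage with top in `B` the condition
still exists, because only earlier stages have to avoid `B`; it is the hit. -/
theorem exists_hit (hext : ∀ c, c ≤ ext c) (hB : IsStationary B) :
    ∃ i ∈ B, ∃ q ≥ p, ∀ η < i, ∃ c ≥ p, ext c ≤ q ∧ η < c.top ∧ (ext c).top < i := by
  have hex : ∃ ξ, Lim ξ ∧ (run p ext B ξ).top ∈ B := by
    by_contra hcon
    push Not at hcon
    have hcont := fun ξ => continues_run_of_forall_notMem (p := p) hext hB (ξ := ξ)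
      fun ζ _ hl => hcon ζ hl
    have hmono : StrictMono fun ξ => (run p ext B ξ).top := fun ζ ξ h =>
      top_strictMono ((hext _).trans_lt ((hcont ξ).ext_lt ζ h))
    obtain ⟨δ, ⟨hδB, hδlim⟩, hδ⟩ := isStationary_inter hB
      (isClub_acc (isClub_Ioi (Classical.arbitrary K)))
      (isClub_closurePoints fun ξ => (run p ext B ξ).top)
    have hl : Lim δ := hδlim.lim
    refine hcon δ hl ?_
    convert hδB
    refine le_antisymm ?_ hmono.le_apply
    by_contra hlt
    obtain ⟨ζ, hζ, h⟩ := (hcont δ).lub hl δ (not_le.1 hlt)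
    exact absurd (hδ ζ hζ) h.not_gt
  obtain ⟨ξ, ⟨hl, hξB⟩, hmin⟩ := exists_least (s := {ξ | Lim ξ ∧ (run p ext B ξ).top ∈ B}) hex
  have hnot : ∀ ζ < ξ, Lim ζ → (run p ext B ζ).top ∉ B := fun ζ hζ hζl h =>
    absurd (hmin ζ ⟨hζl, h⟩) (not_le.2 hζ)
  have hcont := continues_run_of_forall_notMem (p := p) hext hB hnot
  refine ⟨_, hξB, _, hcont.lt.le, fun η hη => ?_⟩
  obtain ⟨ζ, hζ, h⟩ := hcont.lub hl η hη
  exact ⟨run p ext B ζ, (continues_run_of_forall_notMem hext hB fun ζ' hζ' =>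
    hnot ζ' (hζ'.trans hζ)).lt.le, (hcont.ext_lt ζ hζ).le, h, top_strictMono (hcont.ext_lt ζ hζ)⟩

end Run

end Regular

end LadderTree

end LargeRegular

/-! ### The dichotomy between the two trees -/

theorem proposition4 (κ : Cardinal.{u}) (hreg : κ.IsRegular) (hκ : ℵ₁ < κ) :
    ∃ (T : Type u) (_ : PartialOrder T),
      SetForcing.IsSemiProperTree (Order.succ (2 ^ κ)) κ T := by
  have := largeRegular_ord_toType hreg hκ
  have hK : #κ.ord.ToType = κ := mk_ord_toType κ
  by_cases hchain : ∀ S : Set (LargeRegular.LadderTree κ.ord.ToType), IsChain (· ≤ ·) S →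
      ∃ b, ∀ c ∈ S, c.top < b
  · refine ⟨_, _, SetForcing.isSemiProperTree_of_hits
      LargeRegular.LadderTree.top_strictMono (fun _ _ _ => LargeRegular.LadderTree.le_total_of_le)
      (by simpa only [hK] using LargeRegular.LadderTree.mk_le (K := κ.ord.ToType))
      (fun t ξ => ?_) hchain
      fun p ext hext S hS => LargeRegular.LadderTree.exists_hit hext hS⟩
    obtain ⟨ζ, hζ⟩ := exists_gt (max ξ t.top)
    obtain ⟨q, hq, rfl⟩ := t.exists_top_eq ((le_max_right _ _).trans_lt hζ)
    exact ⟨q, hq, (le_max_left _ _).trans_lt hζ⟩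
  · push Not at hchain
    obtain ⟨S, hS, hub⟩ := hchain
    have hC := LargeRegular.LadderTree.unthreaded_unionC hS hub
    obtain ⟨E₀, hE₀, hguess⟩ := hC.exists_gapEnds
    have := LargeRegular.GapTree.nonempty (C := LargeRegular.LadderTree.unionC S) (E₀ := E₀)
    exact ⟨_, _, SetForcing.isSemiProperTree_of_hits
      LargeRegular.GapTree.top_strictMono (fun _ _ _ => LargeRegular.GapTree.le_total_of_le)
      (by simpa only [hK] using
        LargeRegular.GapTree.mk_le (C := LargeRegular.LadderTree.unionC S) (E₀ := E₀))
      LargeRegular.GapTree.exists_lt_top (fun B hB => LargeRegular.GapTree.chain_bounded hguess hB)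
      fun p ext hext B hB => LargeRegular.GapTree.exists_hit hext hC hE₀ hB⟩
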